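/- Let $a_1,\dots,a_s\in\mathbb{R}^n$, $c_1,\dots,c_s\in\mathbb{R}$, let $C=\{x\in\mathbb{R}^n : \langle a_j,x\rangle\le c_j,\ j=1,\dots,s\}$, and let $U\subset\mathbb{R}^d$. Let $g:\mathbb{R}^n\times\mathbb{R}^d\to\mathbb{R}^n$ be Lipschitz continuous, jointly in $(x,u)$, around each point of $C\times U$. Notation. $N(x;C)$ is the normal cone of convex analysis (empty for $x\notin C$), $N_C$ is the mapping $x\mapsto N(x;C)$, and $F(x,u)=N(x;C)+g(x,u)$. For a set $\Omega$ in a Euclidean space and $x\in\Omega$, the limiting normal cone $N_\Omega(x)$ consists of all limits $\lim_k\alpha_k(x_k-p_k)$ with $x_k\to x$, $\alpha_k\ge0$, and $p_k\in\Omega$ a nearest point of $\Omega$ to $x_k$. For a set-valued mapping $G$ and $y\in G(x)$, the coderivative is $D^*G(x,y)(w)=\{v : (v,-w)\in N_{\mathrm{gph}\,G}(x,y)\}$, with domain $\mathrm{dom}\,D^*G(x,y)=\{w : D^*G(x,y)(w)\ne\emptyset\}$. For a real-valued function $\varphi$, $\partial\varphi(x)=\{v : (v,-1)\in N_{\mathrm{epi}\,\varphi}(x,\varphi(x))\}$.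 Finally, $I(x)=\{j : \langle a_j,x\rangle=c_j\}$, $I_0(w)=\{j\in I(x) : \langle a_j,w\rangle=0\}$, $I_>(w)=\{j\in I(x) : \langle a_j,w\rangle>0\}$. Theorem. Let $(x,u)\in C\times U$, $\omega\in F(x,u)$, and put $\bar v=\omega-g(x,u)\in N(x;C)$. (1) For every $w\in\mathbb{R}^n$, if $z\in D^*F(x,u,\omega)(w)$, then $w\in\mathrm{dom}\,D^*N_C(x,\bar v)$ and $$z\in\partial\langle w,g\rangle(x,u)+\Big(\sum_{j\in I_0(w)\cup I_>(w)}\gamma^j a_j,\;0\Big)$$ for some $\gamma^j\in\mathbb{R}$ $(j\in I_0(w))$ and $\gamma^j\ge0$ $(j\in I_>(w))$. (2) For every $M>\|\bar v\|$, the mapping $F_1(x)=N(x;C)\cap M\mathbb{B}$, where $\mathbb{B}$ is the closed unit ball, satisfies $\mathrm{dom}\,D^*F_1(x,\bar v)=\mathrm{dom}\,D^*N_C(x,\bar v)$. (3) If the family $(a_j)_{j\in I(x)}$ is linearly independent (LICQ), then $$\mathrm{dom}\,D^*N_C(x,\bar v)=\Big\{w : \exists\,\lambda^j\ge0\ (j\in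 I(x)),\ \bar v=\sum_{j\in I(x)}\lambda^j a_j,\ \lambda^j>0\Rightarrow\langle a_j,w\rangle=0\Big\}.$$ (4) If $g$ is $\mathcal{C}^1$ around $(x,u)$, then for every $w\in\mathbb{R}^n$ each $z\in D^*F(x,u,\omega)(w)$ satisfies $w\in\mathrm{dom}\,D^*N_C(x,\bar v)$ and $$z=\Big(\nabla_xg(x,u)^*w+\sum_{j\in I_0(w)\cup I_>(w)}\gamma^j a_j,\;\nabla_ug(x,u)^*w\Big)$$ with $\gamma^j\in\mathbb{R}$ for $j\in I_0(w)$ and $\gamma^j\ge0$ for $j\in I_>(w)$. If moreover $(a_j)_{j\in I(x)}$ is linearly independent, then for every $w\in\mathrm{dom}\,D^*N_C(x,\bar v)$ the set $D^*F(x,u,\omega)(w)$ is equal to the set of all such $z$ (and it is empty for all other $w$). -/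

import Mathlib

open Set Filter Topology
open scoped NNReal

/-- The Euclidean space `ℝⁿ`. -/
abbrev Euc (n : ℕ) : Type := EuclideanSpace ℝ (Fin n)

/-! ### First-order generalized differentiation

All products carry the Euclidean (`L²`) structure, `WithLp 2 (V × W)`. -/

section Generalized

variable {V W : Type*} [NormedAddCommGroup V] [InnerProductSpace ℝ V]
  [NormedAddCommGroup W] [InnerProductSpace ℝ W]

/-- The Euclidean projection `Π(x; Ω)`: the set of all nearest points to `x` in `Ω`. -/
def proj (Ω : Set V) (x : V) : Set V := {p | p ∈ Ω ∧ dist x p = Metric.infDist x Ω}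

/-- The basic (limiting, Mordukhovich) normal cone
`N(x; Ω) = Lim sup_{x' → x} cone [x' - Π(x'; Ω)]` at `x ∈ Ω`, where
`cone Λ = {α v | α ≥ 0, v ∈ Λ}`; it is empty for `x ∉ Ω`. -/
def limitingNormalCone (Ω : Set V) (x : V) : Set V :=
  {z | x ∈ Ω ∧ ∃ (xk zk : ℕ → V), Tendsto xk atTop (𝓝 x) ∧ Tendsto zk atTop (𝓝 z) ∧
    ∀ k, ∃ α : ℝ, 0 ≤ α ∧ ∃ p ∈ proj Ω (xk k), zk k = α • (xk k - p)}

/-- The graph of a set-valued mapping. -/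
def gph (F : V → Set W) : Set (WithLp 2 (V × W)) := {q | q.snd ∈ F q.fst}

/-- The coderivative `D*F(x, y)(w) = {v | (v, -w) ∈ N((x, y); gph F)}`. -/
def coderivative (F : V → Set W) (x : V) (y : W) (w : W) : Set V :=
  {v | WithLp.toLp 2 (v, -w) ∈ limitingNormalCone (gph F) (WithLp.toLp 2 (x, y))}

/-- The domain `{w | D*F(x, y)(w) ≠ ∅}` of the coderivative of `F` at `(x, y)`. -/
def domCoderivative (F : V → Set W) (x : V) (y : W) : Set W :=
  {w | (coderivative F x y w).Nonempty}

/-- The epigraph of a real-valued function. -/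
def epi (φ : V → ℝ) : Set (WithLp 2 (V × ℝ)) := {q | φ q.fst ≤ q.snd}

/-- The (limiting) subdifferential `∂φ(x) = {v | (v, -1) ∈ N((x, φ(x)); epi φ)}`. -/
def limitingSubdifferential (φ : V → ℝ) (x : V) : Set V :=
  {v | WithLp.toLp 2 (v, (-1 : ℝ)) ∈ limitingNormalCone (epi φ) (WithLp.toLp 2 (x, φ x))}

/-- The normal cone of convex analysis; it is empty for `x ∉ C`. -/
def convexNormalCone (C : Set V) (x : V) : Set V :=
  {v | x ∈ C ∧ ∀ y ∈ C, inner ℝ v (y - x) ≤ 0}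

end Generalized

/-! ### The polyhedron and the sweeping mapping -/

section Sweeping

variable {n d s : ℕ}

/-- The convex polyhedron `C = {x | ⟨a j, x⟩ ≤ c j for all j}`. -/
def polyhedron (a : Fin s → Euc n) (c : Fin s → ℝ) : Set (Euc n) :=
  {x | ∀ j, inner ℝ (a j) x ≤ c j}

open Classical in
/-- The active constraint indices `I(x)`. -/
noncomputable def activeIdx (a : Fin s → Euc n) (c : Fin s → ℝ) (x : Euc n) : Finset (Fin s) :=
  Finset.univ.filter fun j => inner ℝ (a j) x = c j

open Classical in
/-- `I₀(w)`: the indices `j ∈ I(x)` with `⟨a j, w⟩ = 0`. -/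
noncomputable def idxZero (a : Fin s → Euc n) (c : Fin s → ℝ) (x w : Euc n) : Finset (Fin s) :=
  (activeIdx a c x).filter fun j => inner ℝ (a j) w = 0

open Classical in
/-- `I_>(w)`: the indices `j ∈ I(x)` with `⟨a j, w⟩ > 0`. -/
noncomputable def idxPos (a : Fin s → Euc n) (c : Fin s → ℝ) (x w : Euc n) : Finset (Fin s) :=
  (activeIdx a c x).filter fun j => 0 < inner ℝ (a j) w

/-- The normal cone mapping `N_C` of the polyhedron. -/
def polyNormal (a : Fin s → Euc n) (c : Fin s → ℝ) (x : Euc n) : Set (Euc n) :=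
  convexNormalCone (polyhedron a c) x

/-- The truncated normal cone mapping `F₁(x) = N(x; C) ∩ M𝔹`. -/
def truncNormal (a : Fin s → Euc n) (c : Fin s → ℝ) (M : ℝ) (x : Euc n) : Set (Euc n) :=
  polyNormal a c x ∩ Metric.closedBall 0 M

/-- The sweeping mapping `F(x, u) = N(x; C) + g(x, u)`. -/
def sweepingMap (a : Fin s → Euc n) (c : Fin s → ℝ) (g : Euc n → Euc d → Euc n)
    (p : WithLp 2 (Euc n × Euc d)) : Set (Euc n) :=
  {ω | ∃ v ∈ polyNormal a c p.fst, ω = v + g p.fst p.snd}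

/-- The scalarization `⟨w, g⟩(x, u) = ⟨w, g(x, u)⟩`. -/
noncomputable def scalarization (g : Euc n → Euc d → Euc n) (w : Euc n)
    (p : WithLp 2 (Euc n × Euc d)) : ℝ :=
  inner ℝ w (g p.fst p.snd)

/-- The vectors `∑_{j ∈ I₀(w) ∪ I_>(w)} γ j • a j` with `γ j ∈ ℝ` for `j ∈ I₀(w)` and
`γ j ≥ 0` for `j ∈ I_>(w)`. -/
def multiplierSums (a : Fin s → Euc n) (c : Fin s → ℝ) (x w : Euc n) : Set (Euc n) :=
  {y | ∃ γ : Fin s → ℝ, (∀ j ∈ idxPos a c x w, 0 ≤ γ j) ∧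
    y = ∑ j ∈ idxZero a c x w ∪ idxPos a c x w, γ j • a j}

/-- Lipschitz continuity of `g`, jointly in both variables, around `(x, u)`. -/
def LipschitzAround (g : Euc n → Euc d → Euc n) (x : Euc n) (u : Euc d) : Prop :=
  ∃ K : ℝ≥0, ∃ t ∈ 𝓝 (x, u), LipschitzOnWith K (Function.uncurry g) t

/-- `(∇ₓ g(x, u)* w, ∇ᵤ g(x, u)* w)`: the adjoint partial Jacobians of `g` applied to `w`. -/
noncomputable def adjointJacobian (g : Euc n → Euc d → Euc n) (x : Euc n) (u : Euc d)
    (w : Euc n) : WithLp 2 (Euc n × Euc d) :=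
  WithLp.toLp 2
    (ContinuousLinearMap.adjoint (fderiv ℝ (fun y => g y u) x) w,
      ContinuousLinearMap.adjoint (fderiv ℝ (fun v => g x v) u) w)

end Sweeping

/-! ### Comparison of the `L²` norm of a product with the norms of its components. -/

section ProductNorm

variable {V W : Type*} [NormedAddCommGroup V] [NormedAddCommGroup W]

/-! For a locally closed set in finite dimensions, `z` is a limiting normal at `x` exactly when, for
every `ε > 0`, the same vector `z` is an `ε`-normal at some point of the set within `ε` of `x`
(`exists_isEpsNormal`, `mem_limitingNormalCone_of_isEpsNormal`). Every coderivative thus becomes a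
family of first-order inequalities over a graph, with no sequences left.

For `N_C`, an `ε`-normal at a nearby graph point `(x', v')` is tested by moving `x'` or `v'` alone.
The admissible directions depend only on two index sets: `J`, active at `x'`, and `I ⊆ J`, carrying
positive multipliers of `v'`. There are finitely many pairs, so one serves all `ε`; letting `ε → 0`
and applying Farkas' lemma gives the upper estimate (`exists_index_of_mem_coderivative`). Under
LICQ, multipliers are read off by a dual family, and a small shift of `(x, v)` realizes the largest
`J` and `I` compatible with `w`, where the required inequality holds without error
(`mem_coderivative_polyNormal_of_linearIndependent`).

The map `(x, u, ω) ↦ (x, u, ω - g(x, u))` straightens `gph F`, leaving the Lipschitz function `⟨w,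
g⟩` plus the constraint `v ∈ N(x; C)`. Doubling `x` and penalizing the gap quadratically separates
the two (`exists_decoupling`); the penalty gradients are bounded by the Lipschitz constant, and a
cluster point of them splits `z` into a subgradient of `⟨w, g⟩` and an element of `D*N_C`. If `g` is
`C¹`, strict differentiability makes the separation exact and reversible
(`mem_coderivative_sweepingMap_iff`). Truncation changes nothing, since the two graphs agree near
`(x, v̄)`. -/

theorem toLp_norm_le_add (v : V) (w : W) : ‖WithLp.toLp 2 (v, w)‖ ≤ ‖v‖ + ‖w‖ := by
  rw [WithLp.prod_norm_eq_of_L2]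
  refine Real.sqrt_le_iff.2 ⟨by positivity, ?_⟩
  change ‖v‖ ^ 2 + ‖w‖ ^ 2 ≤ (‖v‖ + ‖w‖) ^ 2
  nlinarith [norm_nonneg v, norm_nonneg w]

theorem norm_fst_le_toLp (q : WithLp 2 (V × W)) : ‖q.fst‖ ≤ ‖q‖ := by
  rw [WithLp.prod_norm_eq_of_L2]
  exact Real.le_sqrt_of_sq_le (by nlinarith [sq_nonneg ‖q.snd‖])

theorem norm_snd_le_toLp (q : WithLp 2 (V × W)) : ‖q.snd‖ ≤ ‖q‖ := by
  rw [WithLp.prod_norm_eq_of_L2]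
  exact Real.le_sqrt_of_sq_le (by nlinarith [sq_nonneg ‖q.fst‖])

end ProductNorm

/-! ### Limiting normals and coderivatives through `ε`-normals. -/

section NormalCones

theorem mem_proj_iff {V : Type*} [NormedAddCommGroup V]
    {Ω : Set V} {x p : V} :
    p ∈ proj Ω x ↔ p ∈ Ω ∧ ∀ y ∈ Ω, dist x p ≤ dist x y := by
  constructor
  · rintro ⟨hp, h⟩
    exact ⟨hp, fun y hy => h ▸ Metric.infDist_le_dist_of_mem hy⟩
  · rintro ⟨hp, h⟩
    exact ⟨hp, le_antisymm ((Metric.le_infDist ⟨p, hp⟩).2 fun {y} hy => h y hy)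
      (Metric.infDist_le_dist_of_mem hp)⟩

variable {V W : Type*} [NormedAddCommGroup V] [InnerProductSpace ℝ V]
  [NormedAddCommGroup W] [InnerProductSpace ℝ W]

/-- `z` is an `ε`-normal (in the sense of Fréchet) to `Ω` at `x`. -/
def IsEpsNormal (Ω : Set V) (ε : ℝ) (x z : V) : Prop :=
  ∀ᶠ y in 𝓝[Ω] x, inner ℝ z (y - x) ≤ ε * ‖y - x‖

theorem inner_sub_le_of_mem_proj {Ω : Set V} {q p : V} (hp : p ∈ proj Ω q) {y : V} (hy : y ∈ Ω) :
    2 * inner ℝ (q - p) (y - p) ≤ ‖y - p‖ ^ 2 := by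
  have h := (mem_proj_iff.1 hp).2 y hy
  rw [dist_eq_norm, dist_eq_norm] at h
  have h2 : ‖q - y‖ ^ 2 = ‖q - p‖ ^ 2 - 2 * inner ℝ (q - p) (y - p) + ‖y - p‖ ^ 2 := by
    rw [← norm_sub_sq_real]; congr 2; abel
  have h3 : ‖q - p‖ ^ 2 ≤ ‖q - y‖ ^ 2 := by gcongr
  linarith

/-- A nearest point `p` of `x_k` serves: `α (x_k - p)` obeys a quadratic estimate at `p`, which is
`o(‖y - p‖)`, and the error `z - z_k` is absorbed into the other half of `ε`. -/
theorem exists_isEpsNormal {Ω : Set V} {x z : V} (hz : z ∈ limitingNormalCone Ω x) {ε : ℝ}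
    (hε : 0 < ε) : ∃ x' ∈ Ω, dist x' x < ε ∧ IsEpsNormal Ω ε x' z := by
  obtain ⟨hx, xk, zk, hxk, hzk, H⟩ := hz
  have e1 := (Metric.tendsto_nhds.1 hxk) (ε / 2) (by positivity)
  have e2 := (Metric.tendsto_nhds.1 hzk) (ε / 2) (by positivity)
  obtain ⟨k, hk1, hk2⟩ := (e1.and e2).exists
  obtain ⟨α, hα, p, hp, hzp⟩ := H k
  refine ⟨p, hp.1, ?_, ?_⟩
  · have := (mem_proj_iff.1 hp).2 x hx
    have t := dist_triangle_left p x (xk k)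
    linarith
  · have hlim : Tendsto (fun y => α * ‖y - p‖) (𝓝[Ω] p) (𝓝 0) := by
      have : Continuous fun y : V => α * ‖y - p‖ := by fun_prop
      simpa using (this.tendsto p).mono_left nhdsWithin_le_nhds
    filter_upwards [hlim.eventually_lt_const (show (0:ℝ) < ε / 2 by positivity),
      self_mem_nhdsWithin] with y hy hyΩ
    have h1 : inner ℝ z (y - p) = inner ℝ (zk k) (y - p) + inner ℝ (z - zk k) (y - p) := by
      rw [← inner_add_left]; congr 1; abel
    have h2 : inner ℝ (z - zk k) (y - p) ≤ ε / 2 * ‖y - p‖ := by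
      refine (real_inner_le_norm _ _).trans ?_
      rw [dist_eq_norm, norm_sub_rev] at hk2
      gcongr
    have h3 : inner ℝ (zk k) (y - p) ≤ ε / 2 * ‖y - p‖ := by
      rw [hzp, inner_smul_left]
      have h4 := inner_sub_le_of_mem_proj hp hyΩ
      have h5 : α * (2 * inner ℝ (xk k - p) (y - p)) ≤ α * ‖y - p‖ ^ 2 := by gcongr
      have h6 : α * ‖y - p‖ * ‖y - p‖ ≤ ε / 2 * ‖y - p‖ := by gcongr
      have h7 : 0 ≤ ε / 2 * ‖y - p‖ := by positivity
      simp only [conj_trivial]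
      nlinarith
    linarith

/-- Local closedness suffices: points outside the ball are farther from `q` than `x'` is. -/
theorem exists_mem_proj {V : Type*} [NormedAddCommGroup V] [ProperSpace V] {Ω : Set V}
    {x q : V} {r : ℝ} (hcl : IsClosed (Ω ∩ Metric.closedBall x r)) {x' : V} (hx' : x' ∈ Ω)
    (h1 : dist x' x < r / 4) (h2 : dist q x' < r / 4) : ∃ p, p ∈ proj Ω q := by
  have hc : IsCompact (Ω ∩ Metric.closedBall x r) := by
    simpa [inter_assoc] using (isCompact_closedBall x r).inter_left hcl
  have hmem : x' ∈ Ω ∩ Metric.closedBall x r :=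
    ⟨hx', by rw [Metric.mem_closedBall]; linarith [dist_nonneg (x := x') (y := x)]⟩
  obtain ⟨p, hp, hpd⟩ := hc.exists_infDist_eq_dist ⟨x', hmem⟩ q
  refine ⟨p, mem_proj_iff.2 ⟨hp.1, fun y hy => ?_⟩⟩
  rw [← hpd]
  by_cases hyb : y ∈ Metric.closedBall x r
  · exact Metric.infDist_le_dist_of_mem ⟨hy, hyb⟩
  · have := Metric.infDist_le_dist_of_mem (x := q) hmem
    rw [Metric.mem_closedBall, not_le] at hyb
    have t1 := dist_triangle_left y x q
    have t2 := dist_triangle q x' x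
    have t3 : 0 ≤ dist x' x := dist_nonneg
    linarith

/-- Project `x' + t z` onto the set for small `t > 0`. The `ε`-normality of `z` keeps the projection
`p` within `O(t ε)` of `x'`, so `(x' + t z - p) / t` is close to `z`. -/
theorem mem_limitingNormalCone_of_isEpsNormal [ProperSpace V] {Ω : Set V} {x z : V} (hx : x ∈ Ω)
    {r : ℝ} (hr : 0 < r) (hcl : IsClosed (Ω ∩ Metric.closedBall x r))
    (H : ∀ ε > 0, ∃ x' ∈ Ω, dist x' x < ε ∧ IsEpsNormal Ω ε x' z) :
    z ∈ limitingNormalCone Ω x := by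
  have key : ∀ ε > 0, ∃ q z' : V, dist q x < ε ∧ dist z' z < ε ∧
      ∃ α : ℝ, 0 ≤ α ∧ ∃ p ∈ proj Ω q, z' = α • (q - p) := by
    intro ε hε
    obtain ⟨x', hx', hd, hN⟩ := H (min (ε / 3) (r / 4)) (by positivity)
    obtain ⟨δ, hδ, hN⟩ := Metric.eventually_nhds_iff.1 (eventually_nhdsWithin_iff.1 hN)
    -- The three bounds put `p` in the `δ`-ball where `z` is tested, keep `x' + t z` near `x`, and
    -- ensure that a projection exists.
    obtain ⟨t, ht, hts⟩ : ∃ t > 0, t * ‖z‖ < min (min (δ / 2) (ε / 3)) (r / 4) := by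
      refine ⟨min (min (δ / 2) (ε / 3)) (r / 4) / (‖z‖ + 1), by positivity, ?_⟩
      rw [div_mul_eq_mul_div, div_lt_iff₀ (by positivity)]
      have : 0 < min (min (δ / 2) (ε / 3)) (r / 4) := by positivity
      nlinarith [norm_nonneg z]
    simp only [lt_min_iff] at hts hd
    have hq : dist (x' + t • z) x' = t * ‖z‖ := by
      simp [dist_eq_norm, norm_smul, abs_of_pos ht]
    obtain ⟨p, hp⟩ := exists_mem_proj hcl hx' hd.2 (q := x' + t • z) (by rw [hq]; exact hts.2)
    have hpx : dist p x' < δ := by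
      have := (mem_proj_iff.1 hp).2 x' hx'
      have t := dist_triangle_left p x' (x' + t • z)
      linarith
    have hin := hN hpx hp.1
    have hin2 : ‖p - x'‖ ^ 2 ≤ 2 * t * inner ℝ z (p - x') := by
      have h := (mem_proj_iff.1 hp).2 x' hx'
      rw [dist_eq_norm, dist_eq_norm] at h
      have h2 : ‖x' + t • z - p‖ ^ 2 =
          ‖x' + t • z - x'‖ ^ 2 - 2 * inner ℝ (x' + t • z - x') (p - x') + ‖p - x'‖ ^ 2 := by
        rw [← norm_sub_sq_real]; congr 2; abel
      have h3 : ‖x' + t • z - p‖ ^ 2 ≤ ‖x' + t • z - x'‖ ^ 2 := by gcongr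
      rw [add_sub_cancel_left, inner_smul_left] at h2
      simp only [conj_trivial] at h2
      rw [add_sub_cancel_left] at h3
      linarith
    have hle : ‖p - x'‖ ≤ 2 * t * (ε / 3) := by
      have h1 : inner ℝ z (p - x') ≤ ε / 3 * ‖p - x'‖ :=
        hin.trans (by gcongr; exact min_le_left _ _)
      have h2 : 2 * t * inner ℝ z (p - x') ≤ 2 * t * (ε / 3 * ‖p - x'‖) := by gcongr
      rcases (norm_nonneg (p - x')).eq_or_lt with h0 | h0
      · rw [← h0]; positivity
      · refine le_of_mul_le_mul_right ?_ h0
        nlinarith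
    refine ⟨x' + t • z, t⁻¹ • (x' + t • z - p), ?_, ?_, t⁻¹, by positivity, p, hp, rfl⟩
    · have := dist_triangle (x' + t • z) x' x
      linarith
    · have : t⁻¹ • (x' + t • z - p) - z = t⁻¹ • (x' - p) := by
        have : x' + t • z - p = t • z + (x' - p) := by abel
        rw [this, smul_add, smul_smul, inv_mul_cancel₀ ht.ne', one_smul, add_sub_cancel_left]
      rw [dist_eq_norm, this, norm_smul, norm_inv, Real.norm_of_nonneg ht.le, norm_sub_rev,
        inv_mul_lt_iff₀ ht]
      nlinarith
  choose! q z' hq hz' hα using key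
  have hpos : ∀ k : ℕ, (0 : ℝ) < 1 / ((k : ℝ) + 1) := fun k => Nat.one_div_pos_of_nat
  refine ⟨hx, fun k => q (1 / ((k : ℝ) + 1)), fun k => z' (1 / ((k : ℝ) + 1)), ?_, ?_,
    fun k => hα _ (hpos k)⟩
  · exact tendsto_iff_dist_tendsto_zero.2 (squeeze_zero (fun _ => dist_nonneg)
      (fun k => (hq _ (hpos k)).le) tendsto_one_div_add_atTop_nhds_zero_nat)
  · exact tendsto_iff_dist_tendsto_zero.2 (squeeze_zero (fun _ => dist_nonneg)
      (fun k => (hz' _ (hpos k)).le) tendsto_one_div_add_atTop_nhds_zero_nat)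

/-- This and the converse `mem_coderivative_of_forall` are the working form of coderivatives: sums
of norms replace the `L²` norm, at the cost of a factor of at most 2. -/
theorem exists_of_mem_coderivative {F : V → Set W} {x v : V} {y w : W}
    (h : v ∈ coderivative F x y w) {ε : ℝ} (hε : 0 < ε) :
    ∃ x' y', y' ∈ F x' ∧ ‖x' - x‖ < ε ∧ ‖y' - y‖ < ε ∧ ∃ δ > 0, ∀ x'' y'', y'' ∈ F x'' →
      ‖x'' - x'‖ < δ → ‖y'' - y'‖ < δ →
      inner ℝ v (x'' - x') - inner ℝ w (y'' - y') ≤ ε * (‖x'' - x'‖ + ‖y'' - y'‖) := by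
  obtain ⟨q, hq, hd, hN⟩ := exists_isEpsNormal h hε
  obtain ⟨δ, hδ, hN⟩ := Metric.eventually_nhds_iff.1 (eventually_nhdsWithin_iff.1 hN)
  rw [dist_eq_norm] at hd
  refine ⟨q.fst, q.snd, hq, (norm_fst_le_toLp (q - WithLp.toLp 2 (x, y))).trans_lt hd,
    (norm_snd_le_toLp (q - WithLp.toLp 2 (x, y))).trans_lt hd, δ / 2, by positivity, ?_⟩
  intro x'' y'' hy hx1 hy1
  have e : WithLp.toLp 2 (x'', y'') - q = WithLp.toLp 2 (x'' - q.fst, y'' - q.snd) := rfl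
  have hb := toLp_norm_le_add (x'' - q.fst) (y'' - q.snd)
  have := @hN (WithLp.toLp 2 (x'', y'')) (by rw [dist_eq_norm, e]; linarith) hy
  rw [e, WithLp.prod_inner_apply] at this
  simp only [inner_neg_left] at this
  have h2 : ε * ‖WithLp.toLp 2 (x'' - q.fst, y'' - q.snd)‖ ≤
    ε * (‖x'' - q.fst‖ + ‖y'' - q.snd‖) := by gcongr
  linarith

theorem mem_coderivative_of_forall [FiniteDimensional ℝ V] [FiniteDimensional ℝ W]
    {F : V → Set W} {x v : V} {y w : W} (hy : y ∈ F x) {r : ℝ} (hr : 0 < r)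
    (hcl : IsClosed (gph F ∩ Metric.closedBall (WithLp.toLp 2 (x, y)) r))
    (H : ∀ ε > 0, ∃ x' y', y' ∈ F x' ∧ ‖x' - x‖ < ε ∧ ‖y' - y‖ < ε ∧ ∃ δ > 0, ∀ x'' y'',
      y'' ∈ F x'' → ‖x'' - x'‖ < δ → ‖y'' - y'‖ < δ →
      inner ℝ v (x'' - x') - inner ℝ w (y'' - y') ≤ ε * (‖x'' - x'‖ + ‖y'' - y'‖)) :
    v ∈ coderivative F x y w := by
  have : FiniteDimensional ℝ (WithLp 2 (V × W)) :=
    (WithLp.linearEquiv 2 ℝ (V × W)).symm.finiteDimensional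
  have : ProperSpace (WithLp 2 (V × W)) := FiniteDimensional.proper ℝ _
  refine mem_limitingNormalCone_of_isEpsNormal hy hr hcl fun ε hε => ?_
  obtain ⟨x', y', hy', hx1, hy1, δ, hδ, h⟩ := H (ε / 2) (by positivity)
  refine ⟨WithLp.toLp 2 (x', y'), hy', ?_, ?_⟩
  · rw [dist_eq_norm]
    have := toLp_norm_le_add (x' - x) (y' - y)
    change ‖WithLp.toLp 2 (x' - x, y' - y)‖ < _
    linarith
  · refine eventually_nhdsWithin_iff.2 (Metric.eventually_nhds_iff.2 ⟨δ, hδ, fun q hq hqF => ?_⟩)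
    rw [dist_eq_norm] at hq
    have h1 := norm_fst_le_toLp (q - WithLp.toLp 2 (x', y'))
    have h2 := norm_snd_le_toLp (q - WithLp.toLp 2 (x', y'))
    have := h q.fst q.snd hqF (h1.trans_lt hq) (h2.trans_lt hq)
    rw [WithLp.prod_inner_apply]
    change inner ℝ v (q.fst - x') + inner ℝ (-w) (q.snd - y') ≤ _
    change ‖q.fst - x'‖ ≤ _ at h1
    change ‖q.snd - y'‖ ≤ _ at h2
    rw [inner_neg_left]
    nlinarith

theorem isEpsNormal_congr {Ω Ω' : Set V} {x : V} (h : ∀ᶠ y in 𝓝 x, y ∈ Ω ↔ y ∈ Ω') (ε : ℝ) (z : V) :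
    IsEpsNormal Ω ε x z ↔ IsEpsNormal Ω' ε x z := by
  rw [IsEpsNormal, IsEpsNormal, eventually_nhdsWithin_iff, eventually_nhdsWithin_iff]
  refine eventually_congr ?_
  filter_upwards [h] with y hy
  rw [hy]

theorem limitingNormalCone_subset_of_eventuallyEq [ProperSpace V] {Ω Ω' : Set V} {x : V}
    (h : ∀ᶠ y in 𝓝 x, y ∈ Ω ↔ y ∈ Ω') (hcl : IsClosed Ω') :
    limitingNormalCone Ω x ⊆ limitingNormalCone Ω' x := by
  intro z hz
  refine mem_limitingNormalCone_of_isEpsNormal (h.self_of_nhds.1 hz.1) one_pos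
    (hcl.inter Metric.isClosed_closedBall) fun ε hε => ?_
  obtain ⟨δ, hδ, hN⟩ := Metric.eventually_nhds_iff.1 h.eventually_nhds
  obtain ⟨x', hx', hd, hz'⟩ := exists_isEpsNormal hz (show 0 < min ε δ by positivity)
  rw [lt_min_iff] at hd
  have hl := hN hd.2
  refine ⟨x', hl.self_of_nhds.1 hx', hd.1, (isEpsNormal_congr hl ε z).1 ?_⟩
  filter_upwards [hz'] with y hy
  exact hy.trans (by gcongr; exact min_le_left _ _)

end NormalCones

/-! ### Farkas' lemma by induction on the number of constraints. -/

section Farkas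

variable {V : Type*} [NormedAddCommGroup V] [InnerProductSpace ℝ V]

/-- The Farkas lemma. -/
theorem farkas {ι : Type*} [DecidableEq ι] (S : Finset ι) (a : ι → V) (z : V)
    (H : ∀ h : V, (∀ j ∈ S, inner ℝ (a j) h ≤ 0) → inner ℝ z h ≤ 0) :
    ∃ γ : ι → ℝ, (∀ j, 0 ≤ γ j) ∧ z = ∑ j ∈ S, γ j • a j := by
  induction S using Finset.induction_on generalizing a z with
  | empty =>
    refine ⟨0, fun _ => le_rfl, ?_⟩
    have := H z (by simp)
    simpa using real_inner_self_nonpos.1 this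
  | insert m S hm ih =>
    -- If constraint `m` is redundant, its multiplier is 0.
    by_cases H' : ∀ h : V, (∀ j ∈ S, inner ℝ (a j) h ≤ 0) → inner ℝ z h ≤ 0
    · obtain ⟨γ, hγ, hz⟩ := ih a z H'
      refine ⟨Function.update γ m 0, fun j => ?_, ?_⟩
      · rcases eq_or_ne j m with rfl | h
        · simp
        · simpa [h] using hγ j
      · rw [Finset.sum_insert hm, hz]
        simp only [Function.update_self, zero_smul, zero_add]
        refine Finset.sum_congr rfl fun j hj => ?_
        rw [Function.update_of_ne (ne_of_mem_of_not_mem hj hm)]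
    · push Not at H'
      obtain ⟨k, hk, hzk⟩ := H'
      have hmk : 0 < inner ℝ (a m) k := by
        by_contra hcon
        refine absurd (H k fun j hj => ?_) (not_le.2 hzk)
        rcases Finset.mem_insert.1 hj with rfl | hj
        · exact not_lt.1 hcon
        · exact hk j hj
      obtain ⟨k₀, hk₀, hzk₀, hmk₀⟩ : ∃ k₀ : V, (∀ j ∈ S, inner ℝ (a j) k₀ ≤ 0) ∧
          0 < inner ℝ z k₀ ∧ inner ℝ (a m) k₀ = 1 := by
        refine ⟨(inner ℝ (a m) k)⁻¹ • k, fun j hj => ?_, ?_, ?_⟩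
        · rw [inner_smul_right]
          exact mul_nonpos_of_nonneg_of_nonpos (by positivity) (hk j hj)
        · rw [inner_smul_right]; positivity
        · rw [inner_smul_right, inv_mul_cancel₀ hmk.ne']
      -- The map `h ↦ h - ⟨a m, h⟩ k₀` projects onto the hyperplane orthogonal to `a m`. Composing
      -- the functionals with it removes constraint `m`.
      obtain ⟨γ, hγ, hz⟩ := ih (fun j => a j - inner ℝ (a j) k₀ • a m)
        (z - inner ℝ z k₀ • a m) (by
          intro h hh
          have := H (h - inner ℝ (a m) h • k₀) (by
            intro j hj
            rcases Finset.mem_insert.1 hj with rfl | hj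
            · rw [inner_sub_right, inner_smul_right, hmk₀]; simp
            · have := hh j hj
              rw [inner_sub_left, inner_smul_left] at this
              rw [inner_sub_right, inner_smul_right]
              simp only [conj_trivial] at this
              linarith)
          rw [inner_sub_right, inner_smul_right] at this
          rw [inner_sub_left, inner_smul_left]
          simp only [conj_trivial]
          linarith)
      -- The coefficient of `a m` collects what the projection subtracted; it is nonnegative because
      -- `⟨z, k₀⟩ > 0` and `⟨a j, k₀⟩ ≤ 0`.
      refine ⟨Function.update γ m (inner ℝ z k₀ - ∑ j ∈ S, γ j * inner ℝ (a j) k₀),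
        fun j => ?_, ?_⟩
      · rcases eq_or_ne j m with rfl | h
        · have : ∑ i ∈ S, γ i * inner ℝ (a i) k₀ ≤ 0 :=
            Finset.sum_nonpos fun i hi => mul_nonpos_of_nonneg_of_nonpos (hγ i) (hk₀ i hi)
          simp only [Function.update_self]
          linarith
        · simpa [h] using hγ j
      · rw [Finset.sum_insert hm, Function.update_self]
        have e : ∑ j ∈ S, Function.update γ m
            (inner ℝ z k₀ - ∑ j ∈ S, γ j * inner ℝ (a j) k₀) j • a j = ∑ j ∈ S, γ j • a j :=
          Finset.sum_congr rfl fun j hj => by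
            rw [Function.update_of_ne (ne_of_mem_of_not_mem hj hm)]
        rw [e, sub_smul, Finset.sum_smul]
        simp only [smul_sub, Finset.sum_sub_distrib, smul_smul] at hz
        have hz' : z = (z - inner ℝ z k₀ • a m) + inner ℝ z k₀ • a m := by abel
        refine hz'.trans ?_
        rw [hz]
        abel

/-- The Farkas lemma with equality constraints. -/
theorem farkas_mixed {ι : Type*} [DecidableEq ι] (I J : Finset ι) (hIJ : I ⊆ J) (a : ι → V) (z : V)
    (H : ∀ h : V, (∀ j ∈ I, inner ℝ (a j) h = 0) → (∀ j ∈ J, inner ℝ (a j) h ≤ 0) →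
      inner ℝ z h ≤ 0) :
    ∃ γ : ι → ℝ, (∀ j ∉ I, 0 ≤ γ j) ∧ (∀ j ∉ J, γ j = 0) ∧ z = ∑ j ∈ J, γ j • a j := by
  -- Each equality is a pair of inequalities: `a j` already occurs in `J`, and the copy of `I`
  -- contributes `-a j`.
  obtain ⟨γ, hγ, hz⟩ := farkas (J.disjSum I) (Sum.elim a fun j => -a j) z (by
    intro h hh
    simp only [Finset.mem_disjSum, or_imp, forall_and, forall_exists_index, and_imp,
      forall_apply_eq_imp_iff₂, Sum.elim_inl, Sum.elim_inr, inner_neg_left] at hh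
    exact H h (fun j hj => le_antisymm (hh.1 j (hIJ hj)) (by linarith [hh.2 j hj])) hh.1)
  refine ⟨fun j => if j ∈ J then γ (Sum.inl j) - (if j ∈ I then γ (Sum.inr j) else 0) else 0,
    fun j hj => ?_, fun j hj => by simp [hj], ?_⟩
  · simp only [hj, if_false, sub_zero]
    split_ifs
    · exact hγ _
    · exact le_rfl
  · rw [hz, Finset.sum_disjSum]
    have : ∑ j ∈ I, γ (Sum.inr j) • -a j =
        ∑ j ∈ J, -((if j ∈ I then γ (Sum.inr j) else 0) • a j) := by
      rw [← Finset.sum_subset hIJ]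
      · exact Finset.sum_congr rfl fun j hj => by simp [hj]
      · intro j _ hj; simp [hj]
    simp only [Sum.elim_inl, Sum.elim_inr]
    rw [this, ← Finset.sum_add_distrib]
    refine Finset.sum_congr rfl fun j hj => ?_
    rw [if_pos hj, sub_smul, sub_eq_add_neg]

end Farkas

/-! ### The polyhedron, its normals, and the upper estimate for `D*N_C`. -/

section Polyhedron

variable {n s : ℕ} {a : Fin s → Euc n} {c : Fin s → ℝ}

theorem mem_activeIdx {x : Euc n} {j : Fin s} : j ∈ activeIdx a c x ↔ inner ℝ (a j) x = c j := by
  simp [activeIdx]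

theorem isClosed_polyhedron : IsClosed (polyhedron a c) := by
  simp only [polyhedron, ofPred_forall]
  exact isClosed_iInter fun j => isClosed_le (by fun_prop) continuous_const

theorem mem_polyhedron_of_mem_polyNormal {x v : Euc n} (h : v ∈ polyNormal a c x) :
    x ∈ polyhedron a c := h.1

theorem eventually_lt_of_not_mem_activeIdx {x : Euc n} (hx : x ∈ polyhedron a c) :
    ∀ᶠ y in 𝓝 x, ∀ j ∉ activeIdx a c x, inner ℝ (a j) y < c j := by
  rw [eventually_all]
  intro j
  by_cases hj : j ∈ activeIdx a c x
  · simp [hj]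
  · have h1 : inner ℝ (a j) x < c j := lt_of_le_of_ne (hx j) fun h => hj (mem_activeIdx.2 h)
    have h2 : Continuous fun y : Euc n => (inner ℝ (a j) y : ℝ) := by fun_prop
    filter_upwards [h2.continuousAt.eventually_lt continuousAt_const h1] with y hy _ using hy

theorem eventually_activeIdx_subset {x : Euc n} (hx : x ∈ polyhedron a c) :
    ∀ᶠ y in 𝓝 x, activeIdx a c y ⊆ activeIdx a c x := by
  filter_upwards [eventually_lt_of_not_mem_activeIdx hx] with y hy j hj
  by_contra hcon
  exact (hy j hcon).ne (mem_activeIdx.1 hj)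

theorem eventually_add_smul_mem_polyhedron {x h : Euc n} (hx : x ∈ polyhedron a c)
    (hh : ∀ j ∈ activeIdx a c x, inner ℝ (a j) h ≤ 0) :
    ∀ᶠ t : ℝ in 𝓝[>] 0, x + t • h ∈ polyhedron a c := by
  have hc : Continuous fun t : ℝ => x + t • h := by fun_prop
  have hl : Tendsto (fun t : ℝ => x + t • h) (𝓝[>] 0) (𝓝 x) := by
    simpa using (hc.tendsto 0).mono_left nhdsWithin_le_nhds
  filter_upwards [hl.eventually (eventually_lt_of_not_mem_activeIdx hx), self_mem_nhdsWithin]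
    with t ht ht0 j
  by_cases hj : j ∈ activeIdx a c x
  · rw [inner_add_right, inner_smul_right, mem_activeIdx.1 hj]
    have := mul_nonpos_of_nonneg_of_nonpos (le_of_lt ht0) (hh j hj)
    linarith
  · exact (ht j hj).le

theorem sum_mem_polyNormal {x : Euc n} (hx : x ∈ polyhedron a c) {S : Finset (Fin s)}
    (hS : S ⊆ activeIdx a c x) {l : Fin s → ℝ} (hl : ∀ j ∈ S, 0 ≤ l j) :
    ∑ j ∈ S, l j • a j ∈ polyNormal a c x := by
  refine ⟨hx, fun y hy => ?_⟩
  rw [sum_inner]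
  refine Finset.sum_nonpos fun j hj => ?_
  rw [inner_smul_left, inner_sub_right, mem_activeIdx.1 (hS hj)]
  exact mul_nonpos_of_nonneg_of_nonpos (hl j hj) (sub_nonpos.2 (hy j))

/-- Directions with `⟨a j, h⟩ ≤ 0` on the active set are feasible for small steps, so `v` is
nonpositive on them and Farkas' lemma applies. -/
theorem exists_multipliers_of_mem_polyNormal {x v : Euc n} (hv : v ∈ polyNormal a c x) :
    ∃ l : Fin s → ℝ, (∀ j, 0 ≤ l j) ∧ v = ∑ j ∈ activeIdx a c x, l j • a j := by
  refine farkas _ _ _ fun h hh => ?_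
  obtain ⟨t, ht, ht0⟩ :=
    ((eventually_add_smul_mem_polyhedron hv.1 hh).and self_mem_nhdsWithin).exists
  have := hv.2 _ ht
  rw [add_sub_cancel_left, inner_smul_right] at this
  exact nonpos_of_mul_nonpos_right this ht0

theorem isClosed_gph_polyNormal : IsClosed (gph (polyNormal a c)) := by
  have : gph (polyNormal a c) = {q | q.fst ∈ polyhedron a c} ∩
      ⋂ y ∈ polyhedron a c, {q | inner ℝ q.snd (y - q.fst) ≤ 0} := by
    ext q
    simp [gph, polyNormal, convexNormalCone]
  rw [this]
  refine (isClosed_polyhedron.preimage (WithLp.continuous_fst 2 _ _)).inter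
    (isClosed_biInter fun y _ => isClosed_le ?_ continuous_const)
  have h1 := WithLp.continuous_fst 2 (Euc n) (Euc n)
  have h2 := WithLp.continuous_snd 2 (Euc n) (Euc n)
  exact h2.inner (continuous_const.sub h1)

/-- Pigeonhole: if every index failed at some positive threshold, no index would work at the least
of these finitely many thresholds. -/
theorem exists_forall_of_forall_exists {ι : Type*} [Finite ι] (P : ι → ℝ → Prop)
    (hP : ∀ i ε ε', ε ≤ ε' → P i ε → P i ε') (h : ∀ ε > 0, ∃ i, P i ε) :
    ∃ i, ∀ ε > 0, P i ε := by
  cases nonempty_fintype ι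
  by_contra! hcon
  choose e he hn using hcon
  obtain ⟨i₀, -⟩ := h 1 one_pos
  obtain ⟨i₁, -, hmin⟩ := Finset.exists_min_image Finset.univ e ⟨i₀, Finset.mem_univ _⟩
  obtain ⟨i, hi⟩ := h (e i₁) (he i₁)
  exact hn i (hP i _ _ (hmin i (Finset.mem_univ _)) hi)

theorem nonpos_of_forall_le_mul {b r : ℝ} (h : ∀ ε > 0, b ≤ ε * r) : b ≤ 0 := by
  have hc : Tendsto (fun ε : ℝ => ε * r) (𝓝[>] 0) (𝓝 0) := by
    have : Continuous fun ε : ℝ => ε * r := by fun_prop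
    simpa using (this.tendsto 0).mono_left nhdsWithin_le_nhds
  exact ge_of_tendsto hc (by filter_upwards [self_mem_nhdsWithin] with ε hε using h ε hε)

/-- The index-set description of coderivatives of `N_C` (an upper estimate). -/
theorem exists_index_of_mem_coderivative {x v w y : Euc n}
    (hy : y ∈ coderivative (polyNormal a c) x v w) :
    ∃ I J : Finset (Fin s), I ⊆ J ∧ J ⊆ activeIdx a c x ∧
      (∃ l : Fin s → ℝ, (∀ j, 0 ≤ l j) ∧ v = ∑ j ∈ I, l j • a j) ∧
      (∀ j ∈ I, inner ℝ (a j) w = 0) ∧ (∀ j ∈ J, 0 ≤ inner ℝ (a j) w) ∧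
      ∃ γ : Fin s → ℝ, (∀ j ∉ I, 0 ≤ γ j) ∧ (∀ j ∉ J, γ j = 0) ∧ y = ∑ j ∈ J, γ j • a j := by
  classical
  have hx : x ∈ polyhedron a c := mem_polyhedron_of_mem_polyNormal (v := v) hy.1
  -- `P` holds the wanted relations up to `ε`, with the cone memberships of `v` and `y` in polar
  -- form so that Farkas' lemma can recover them once `ε → 0`.
  let P : Finset (Fin s) × Finset (Fin s) → ℝ → Prop := fun p ε =>
    p.1 ⊆ p.2 ∧ p.2 ⊆ activeIdx a c x ∧
    (∀ h, (∀ j ∈ p.1, inner ℝ (a j) h ≤ 0) → inner ℝ v h ≤ ε * ‖h‖) ∧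
    (∀ j ∈ p.1, inner ℝ (a j) w ≤ ε * ‖a j‖) ∧ (∀ j ∈ p.2, -inner ℝ (a j) w ≤ ε * ‖a j‖) ∧
    ∀ h, (∀ j ∈ p.1, inner ℝ (a j) h = 0) → (∀ j ∈ p.2, inner ℝ (a j) h ≤ 0) →
      inner ℝ y h ≤ ε * ‖h‖
  obtain ⟨⟨I, J⟩, hP⟩ := exists_forall_of_forall_exists P (by
    rintro ⟨I, J⟩ ε ε' hle ⟨h1, h2, h3, h4, h5, h6⟩
    exact ⟨h1, h2, fun h hh => (h3 h hh).trans (by gcongr), fun j hj => (h4 j hj).trans (by gcongr),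
      fun j hj => (h5 j hj).trans (by gcongr), fun h hh hh' => (h6 h hh hh').trans (by gcongr)⟩) (by
    intro ε hε
    obtain ⟨δ₀, hδ₀, hact⟩ := Metric.eventually_nhds_iff.1 (eventually_activeIdx_subset hx)
    obtain ⟨x', v', hv', hx1, hv1, δ, hδ, H⟩ :=
      exists_of_mem_coderivative hy (show 0 < min ε δ₀ by positivity)
    rw [lt_min_iff] at hx1 hv1
    obtain ⟨l, hl, hvl⟩ := exists_multipliers_of_mem_polyNormal hv'
    have hmin : ∀ r : ℝ, 0 ≤ r → min ε δ₀ * r ≤ ε * r := fun r hr => by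
      gcongr; exact min_le_left _ _
    have hsum : v' = ∑ j ∈ (activeIdx a c x').filter (fun j => 0 < l j), l j • a j := by
      rw [hvl, Finset.sum_filter_of_ne]
      intro j _ hj
      exact lt_of_le_of_ne (hl j) fun h => hj (by rw [← h, zero_smul])
    have hnear : ∀ h : Euc n, ∀ᶠ t : ℝ in 𝓝[>] 0, ‖t • h‖ < δ := fun h => by
      have : Continuous fun t : ℝ => ‖t • h‖ := by fun_prop
      have h0 : Tendsto (fun t : ℝ => ‖t • h‖) (𝓝[>] 0) (𝓝 0) := by
        simpa using (this.tendsto 0).mono_left nhdsWithin_le_nhds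
      exact h0.eventually_lt_const hδ
    -- Test with `x'` frozen and `v'` moved along `k`.
    have hvdir : ∀ k : Euc n, (∀ᶠ t : ℝ in 𝓝[>] 0, v' + t • k ∈ polyNormal a c x') →
        -inner ℝ k w ≤ ε * ‖k‖ := by
      intro k hk
      obtain ⟨t, ⟨htk, htn⟩, ht0⟩ := ((hk.and (hnear k)).and self_mem_nhdsWithin).exists
      have ht0' : (0 : ℝ) < t := ht0
      have := H x' (v' + t • k) htk (by simpa using hδ) (by simpa using htn)
      simp only [sub_self, inner_zero_right, add_sub_cancel_left, inner_smul_right, norm_zero,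
        zero_add, norm_smul, Real.norm_of_nonneg ht0'.le] at this
      have h2 := hmin (t * ‖k‖) (by positivity)
      rw [real_inner_comm]
      refine le_of_mul_le_mul_left ?_ ht0'
      linarith
    refine ⟨((activeIdx a c x').filter fun j => 0 < l j, activeIdx a c x'),
      Finset.filter_subset _ _, hact (by rw [dist_eq_norm]; exact hx1.2), ?_, ?_, ?_, ?_⟩
    -- `v'` lies in the cone generated by `I`, and `v` is within `ε` of `v'`.
    · intro h hh
      have h1 : inner ℝ v' h ≤ 0 := by
        rw [hsum, sum_inner]
        refine Finset.sum_nonpos fun j hj => ?_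
        rw [inner_smul_left]
        exact mul_nonpos_of_nonneg_of_nonpos (hl j) (hh j hj)
      have h2 : inner ℝ v h = inner ℝ v' h - inner ℝ (v' - v) h := by
        rw [← inner_sub_left]; congr 1; abel
      have h3 : -inner ℝ (v' - v) h ≤ ε * ‖h‖ := by
        refine (neg_le_abs _).trans ((abs_real_inner_le_norm _ _).trans ?_)
        gcongr
        exact hv1.1.le
      linarith
    -- A positive multiplier can also be decreased, so `-a j` is an admissible direction.
    · intro j hj
      rw [Finset.mem_filter] at hj
      have := hvdir (-a j) (by
        have : ∀ᶠ t : ℝ in 𝓝[>] 0, t < l j :=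
          (tendsto_id.mono_left nhdsWithin_le_nhds).eventually_lt_const hj.2
        filter_upwards [this] with t ht
        have e : v' + t • -a j = ∑ i ∈ activeIdx a c x', (l i - if i = j then t else 0) • a i := by
          simp only [sub_smul, Finset.sum_sub_distrib, ite_smul, zero_smul,
            Finset.sum_ite_eq', hj.1, if_true]
          rw [← hvl, smul_neg, sub_eq_add_neg]
        rw [e]
        refine sum_mem_polyNormal hv'.1 subset_rfl fun i _ => ?_
        split_ifs with hij
        · subst hij; linarith
        · simpa using hl i)
      simpa using this
    · intro j hj
      refine hvdir (a j) ?_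
      filter_upwards [self_mem_nhdsWithin] with t ht
      have ht : (0 : ℝ) < t := ht
      have e : v' + t • a j = ∑ i ∈ activeIdx a c x', (l i + if i = j then t else 0) • a i := by
        simp only [add_smul, Finset.sum_add_distrib, ite_smul, zero_smul, Finset.sum_ite_eq',
          hj, if_true]
        rw [← hvl]
      rw [e]
      refine sum_mem_polyNormal hv'.1 subset_rfl fun i _ => ?_
      have := hl i
      split_ifs <;> linarith
    -- Now `v'` is frozen and `x'` moves along `h`: the constraints in `I` stay active, so `v'`
    -- remains normal.
    · intro h hI hJ
      obtain ⟨t, ⟨htk, htn⟩, ht0⟩ := (((eventually_add_smul_mem_polyhedron hv'.1 hJ).and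
        (hnear h)).and self_mem_nhdsWithin).exists
      have ht0' : (0 : ℝ) < t := ht0
      have hmem : v' ∈ polyNormal a c (x' + t • h) := by
        rw [hsum]
        refine sum_mem_polyNormal htk (fun j hj => ?_) fun j _ => hl j
        rw [mem_activeIdx, inner_add_right, inner_smul_right, hI j hj, mul_zero, add_zero]
        exact mem_activeIdx.1 (Finset.mem_filter.1 hj).1
      have := H (x' + t • h) v' hmem (by simpa using htn) (by simpa using hδ)
      simp only [sub_self, inner_zero_right, add_sub_cancel_left, inner_smul_right, norm_zero,
        add_zero, norm_smul, Real.norm_of_nonneg ht0'.le, sub_zero] at this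
      have h2 := hmin (t * ‖h‖) (by positivity)
      refine le_of_mul_le_mul_left ?_ ht0'
      linarith)
  have hJ : ∀ j ∈ J, 0 ≤ inner ℝ (a j) w := fun j hj => by
    have := nonpos_of_forall_le_mul fun ε hε => (hP ε hε).2.2.2.2.1 j hj
    linarith
  refine ⟨I, J, (hP 1 one_pos).1, (hP 1 one_pos).2.1,
    farkas _ _ _ fun h hh => nonpos_of_forall_le_mul fun ε hε => (hP ε hε).2.2.1 h hh,
    fun j hj => le_antisymm (nonpos_of_forall_le_mul fun ε hε => (hP ε hε).2.2.2.1 j hj)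
      (hJ j ((hP 1 one_pos).1 hj)), hJ, ?_⟩
  exact farkas_mixed I J (hP 1 one_pos).1 a y fun h h1 h2 =>
    nonpos_of_forall_le_mul fun ε hε => (hP ε hε).2.2.2.2.2 h h1 h2

/-- Indices of `J` with `⟨a j, w⟩ > 0` cannot lie in `I`, where this product vanishes, so their
coefficients are nonnegative. -/
theorem coderivative_polyNormal_subset {x v w y : Euc n}
    (hy : y ∈ coderivative (polyNormal a c) x v w) : y ∈ multiplierSums a c x w := by
  classical
  obtain ⟨I, J, hIJ, hJx, -, hI, hJ, γ, hγ, hγ0, rfl⟩ := exists_index_of_mem_coderivative hy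
  refine ⟨γ, fun j hj => hγ j fun hjI => ?_, Finset.sum_subset (fun j hj => ?_)
    fun j _ hj => by rw [hγ0 j hj, zero_smul]⟩
  · exact (Finset.mem_filter.1 hj).2.ne' (hI j hjI)
  · rw [Finset.mem_union, idxZero, idxPos, Finset.mem_filter, Finset.mem_filter]
    rcases (hJ j hj).eq_or_lt with h | h
    · exact Or.inl ⟨hJx hj, h.symm⟩
    · exact Or.inr ⟨hJx hj, h⟩

theorem exists_multipliers_of_mem_domCoderivative {x v w : Euc n}
    (hw : w ∈ domCoderivative (polyNormal a c) x v) :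
    ∃ l : Fin s → ℝ, (∀ j ∈ activeIdx a c x, 0 ≤ l j) ∧ v = ∑ j ∈ activeIdx a c x, l j • a j ∧
      ∀ j ∈ activeIdx a c x, 0 < l j → inner ℝ (a j) w = 0 := by
  classical
  obtain ⟨y, hy⟩ := hw
  obtain ⟨I, J, hIJ, hJx, ⟨l, hl, rfl⟩, hI, -⟩ := exists_index_of_mem_coderivative hy
  refine ⟨fun j => if j ∈ I then l j else 0, fun j _ => ?_, ?_, fun j _ hj => ?_⟩
  · beta_reduce
    split_ifs
    exacts [hl j, le_rfl]
  · rw [← Finset.sum_subset (hIJ.trans hJx)]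
    · exact Finset.sum_congr rfl fun j hj => by simp [hj]
    · intro j _ hj; simp [hj]
  · by_contra hcon
    have : j ∉ I := fun h => hcon (hI j h)
    simp [this] at hj

/-- Coordinates from a left inverse of the linear combination map, represented as vectors by Riesz.
-/
theorem exists_dual_family {ι : Type*} {S : Finset ι} {b : ι → Euc n}
    (hli : LinearIndependent ℝ (fun j : {j // j ∈ S} => b j)) :
    ∃ e : ι → Euc n, ∀ i ∈ S, ∀ j ∈ S,
      (i ≠ j → inner ℝ (b i) (e j) = 0) ∧ inner ℝ (b j) (e j) = 1 := by
  classical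
  obtain ⟨g, hg⟩ := LinearMap.exists_leftInverse_of_injective _ (LinearMap.ker_eq_bot.2 hli)
  have hgb : ∀ j : {j // j ∈ S}, g (b j) = Finsupp.single j 1 := fun j => by
    simpa using LinearMap.congr_fun hg (Finsupp.single j 1)
  refine ⟨fun j => if h : j ∈ S then (InnerProductSpace.toDual ℝ (Euc n)).symm
    (LinearMap.toContinuousLinearMap (Finsupp.lapply (⟨j, h⟩ : {j // j ∈ S}) ∘ₗ g)) else 0,
    fun i hi j hj => ⟨fun hij => ?_, ?_⟩⟩
  · beta_reduce
    rw [dif_pos hj, real_inner_comm, InnerProductSpace.toDual_symm_apply]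
    have hg := hgb ⟨i, hi⟩
    simp only at hg
    simp [hg, hij]
  · beta_reduce
    rw [dif_pos hj, real_inner_comm, InnerProductSpace.toDual_symm_apply]
    have hg := hgb ⟨j, hj⟩
    simp only at hg
    simp [hg]

end Polyhedron

/-! ### Exact formulas under LICQ, and truncation. -/

section LICQ

variable {n s : ℕ} {a : Fin s → Euc n} {c : Fin s → ℝ}

theorem idxZero_subset (x w : Euc n) : idxZero a c x w ⊆ activeIdx a c x :=
  Finset.filter_subset _ _

theorem idxPos_subset (x w : Euc n) : idxPos a c x w ⊆ activeIdx a c x :=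
  Finset.filter_subset _ _

theorem inner_sum_dual {I S : Finset (Fin s)} {e : Fin s → Euc n}
    (he : ∀ i ∈ I, ∀ j ∈ I, (i ≠ j → inner ℝ (a i) (e j) = 0) ∧ inner ℝ (a j) (e j) = 1)
    (hS : S ⊆ I) (μ : Fin s → ℝ) {j : Fin s} (hj : j ∈ I) :
    inner ℝ (∑ i ∈ S, μ i • a i) (e j) = if j ∈ S then μ j else 0 := by
  rw [sum_inner]
  simp only [inner_smul_left, conj_trivial]
  split_ifs with h
  · rw [Finset.sum_eq_single j, (he j hj j hj).2, mul_one]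
    · intro i hi hij
      rw [(he i (hS hi) j hj).1 hij, mul_zero]
    · exact fun h' => absurd h h'
  · refine Finset.sum_eq_zero fun i hi => ?_
    rw [(he i (hS hi) j hj).1 (fun hij => h (hij ▸ hi)), mul_zero]

/-- Shift `x` so that exactly `J = I₀(w) ∪ I_>(w)` stays active, and `v` so that all multipliers on
`Z = I₀(w)` become positive. Near the shifted pair, graph points have active sets between `Z` and
`J`, which gives the normal inequality with zero error. -/
theorem mem_coderivative_polyNormal_of_linearIndependent {x v w y : Euc n}
    (hx : x ∈ polyhedron a c)
    (hli : LinearIndependent ℝ (fun j : {j // j ∈ activeIdx a c x} => a j))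
    {l : Fin s → ℝ} (hl : ∀ j ∈ activeIdx a c x, 0 ≤ l j)
    (hv : v = ∑ j ∈ activeIdx a c x, l j • a j)
    (hw : ∀ j ∈ activeIdx a c x, 0 < l j → inner ℝ (a j) w = 0)
    (hy : y ∈ multiplierSums a c x w) : y ∈ coderivative (polyNormal a c) x v w := by
  classical
  obtain ⟨e, he⟩ := exists_dual_family hli
  obtain ⟨γ, hγ, rfl⟩ := hy
  have hvmem : v ∈ polyNormal a c x := hv ▸ sum_mem_polyNormal hx subset_rfl hl
  set Z := idxZero a c x w with hZ
  set J := Z ∪ idxPos a c x w with hJ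
  have hZI : Z ⊆ activeIdx a c x := idxZero_subset x w
  have hJI : J ⊆ activeIdx a c x := Finset.union_subset hZI (idxPos_subset x w)
  have hwZ : ∀ j ∈ Z, inner ℝ (a j) w = 0 := fun j hj => (Finset.mem_filter.1 hj).2
  have hwJ : ∀ j ∈ J, 0 ≤ inner ℝ (a j) w := fun j hj => by
    rcases Finset.mem_union.1 hj with h | h
    · exact (hwZ j h).ge
    · exact (Finset.mem_filter.1 h).2.le
  have hvZ : v = ∑ j ∈ Z, l j • a j := by
    rw [hv]
    refine (Finset.sum_subset hZI fun j hj hjZ => ?_).symm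
    have : ¬ 0 < l j := fun h => hjZ (Finset.mem_filter.2 ⟨hj, hw j hj h⟩)
    rw [le_antisymm (not_lt.1 this) (hl j hj), zero_smul]
  -- Moving along `h₀` leaves the constraints of `J` tight and makes the other active ones strict.
  set h₀ : Euc n := -∑ j ∈ activeIdx a c x \ J, e j with hh₀
  have hah : ∀ i ∈ activeIdx a c x, inner ℝ (a i) h₀ = if i ∈ J then 0 else -1 := by
    intro i hi
    rw [hh₀, inner_neg_right, inner_sum]
    split_ifs with hiJ
    · rw [Finset.sum_eq_zero, neg_zero]
      intro j hj
      rw [Finset.mem_sdiff] at hj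
      exact (he i hi j hj.1).1 fun h => hj.2 (h ▸ hiJ)
    · rw [Finset.sum_eq_single i, (he i hi i hi).2]
      · intro j hj hji
        exact (he i hi j (Finset.mem_sdiff.1 hj).1).1 hji.symm
      · exact fun h => absurd (Finset.mem_sdiff.2 ⟨hi, hiJ⟩) h
  refine mem_coderivative_of_forall hvmem one_pos
    (isClosed_gph_polyNormal.inter Metric.isClosed_closedBall) fun ε hε => ?_
  have hnear : ∀ h : Euc n, ∀ᶠ t : ℝ in 𝓝[>] 0, ‖t • h‖ < ε := fun h => by
    have : Continuous fun t : ℝ => ‖t • h‖ := by fun_prop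
    have h0 : Tendsto (fun t : ℝ => ‖t • h‖) (𝓝[>] 0) (𝓝 0) := by
      simpa using (this.tendsto 0).mono_left nhdsWithin_le_nhds
    exact h0.eventually_lt_const hε
  have hlt : ∀ᶠ t : ℝ in 𝓝[>] 0, ∀ j ∉ activeIdx a c x, inner ℝ (a j) (x + t • h₀) < c j := by
    have hc : Continuous fun t : ℝ => x + t • h₀ := by fun_prop
    have hl : Tendsto (fun t : ℝ => x + t • h₀) (𝓝[>] 0) (𝓝 x) := by
      simpa using (hc.tendsto 0).mono_left nhdsWithin_le_nhds
    exact hl.eventually (eventually_lt_of_not_mem_activeIdx hx)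
  obtain ⟨t, ⟨⟨⟨htC, hth⟩, htZ⟩, hlt⟩, ht0⟩ :=
    ((((eventually_add_smul_mem_polyhedron hx (h := h₀) fun j hj => by
      rw [hah j hj]; split_ifs <;> norm_num).and (hnear h₀)).and
      (hnear (∑ j ∈ Z, a j))).and hlt |>.and self_mem_nhdsWithin).exists
  have ht : (0 : ℝ) < t := ht0
  have hact : activeIdx a c (x + t • h₀) = J := by
    ext j
    rw [mem_activeIdx]
    by_cases hj : j ∈ activeIdx a c x
    · rw [inner_add_right, inner_smul_right, hah j hj, mem_activeIdx.1 hj]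
      split_ifs with hjJ <;> simp [hjJ, ht.ne']
    · exact ⟨fun h => absurd h (hlt j hj).ne, fun h => absurd (hJI h) hj⟩
  have hv' : v + t • ∑ j ∈ Z, a j = ∑ j ∈ Z, (l j + t) • a j := by
    simp only [add_smul, Finset.sum_add_distrib, ← Finset.smul_sum, ← hvZ]
  refine ⟨x + t • h₀, v + t • ∑ j ∈ Z, a j, ?_, by simpa using hth, by simpa using htZ, ?_⟩
  · rw [hv']
    refine sum_mem_polyNormal htC (hact ▸ Finset.subset_union_left) fun j hj => ?_
    linarith [hl j (hZI hj)]
  obtain ⟨δ₁, hδ₁, hx'⟩ := Metric.eventually_nhds_iff.1 (eventually_activeIdx_subset htC)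
  -- `⟨·, e j⟩` reads the multiplier of `a j`; its positivity is an open condition and forces `j` to
  -- be active at nearby graph points.
  have hvn : ∀ᶠ v' in 𝓝 (v + t • ∑ j ∈ Z, a j), ∀ j ∈ Z, 0 < inner ℝ v' (e j) := by
    rw [Finset.eventually_all]
    intro j hj
    have hc : Continuous fun v' : Euc n => (inner ℝ v' (e j) : ℝ) := by fun_prop
    refine continuousAt_const.eventually_lt hc.continuousAt ?_
    rw [hv', inner_sum_dual he hZI _ (hZI hj), if_pos hj]
    linarith [hl j (hZI hj)]
  obtain ⟨δ₂, hδ₂, hvn⟩ := Metric.eventually_nhds_iff.1 hvn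
  refine ⟨min δ₁ δ₂, by positivity, fun x'' v'' hv'' hxd hvd => ?_⟩
  rw [lt_min_iff, ← dist_eq_norm] at hxd hvd
  have hsub := hx' hxd.1
  rw [hact] at hsub
  obtain ⟨μ, hμ, hvμ⟩ := exists_multipliers_of_mem_polyNormal hv''
  have hZsub : Z ⊆ activeIdx a c x'' := fun j hj => by
    by_contra hcon
    have := hvn hvd.2 j hj
    rw [hvμ, inner_sum_dual he (hsub.trans hJI) _ (hZI hj), if_neg hcon] at this
    exact lt_irrefl _ this
  have hJx : ∀ j ∈ J, inner ℝ (a j) (x + t • h₀) = c j := fun j hj =>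
    mem_activeIdx.1 (hact.symm ▸ hj)
  have h1 : inner ℝ (∑ j ∈ J, γ j • a j) (x'' - (x + t • h₀)) ≤ 0 := by
    rw [sum_inner]
    refine Finset.sum_nonpos fun j hj => ?_
    rw [inner_smul_left, inner_sub_right, hJx j hj]
    rcases Finset.mem_union.1 hj with h | h
    · rw [mem_activeIdx.1 (hZsub h), sub_self, mul_zero]
    · exact mul_nonpos_of_nonneg_of_nonpos (hγ j h) (sub_nonpos.2 (hv''.1 j))
  have h2 : 0 ≤ inner ℝ w (v'' - (v + t • ∑ j ∈ Z, a j)) := by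
    rw [inner_sub_right, hv', hvμ, inner_sum, inner_sum]
    have e1 : ∑ i ∈ Z, inner ℝ w ((l i + t) • a i) = (0 : ℝ) :=
      Finset.sum_eq_zero fun j hj => by
        rw [inner_smul_right, real_inner_comm, hwZ j hj, mul_zero]
    have e2 : (0 : ℝ) ≤ ∑ i ∈ activeIdx a c x'', inner ℝ w (μ i • a i) :=
      Finset.sum_nonneg fun j hj => by
        rw [inner_smul_right, real_inner_comm]
        exact mul_nonneg (hμ j) (hwJ j (hsub hj))
    rw [e1]
    linarith
  have h3 : 0 ≤ ε * (‖x'' - (x + t • h₀)‖ + ‖v'' - (v + t • ∑ j ∈ Z, a j)‖) := by positivity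
  linarith

theorem domCoderivative_polyNormal_eq {x v : Euc n} (hx : x ∈ polyhedron a c)
    (hli : LinearIndependent ℝ (fun j : {j // j ∈ activeIdx a c x} => a j)) :
    domCoderivative (polyNormal a c) x v =
      {w | ∃ l : Fin s → ℝ, (∀ j ∈ activeIdx a c x, 0 ≤ l j) ∧
        v = ∑ j ∈ activeIdx a c x, l j • a j ∧
        ∀ j ∈ activeIdx a c x, 0 < l j → inner ℝ (a j) w = 0} := by
  ext w
  refine ⟨exists_multipliers_of_mem_domCoderivative, fun ⟨l, hl, hv, hw⟩ => ⟨0, ?_⟩⟩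
  exact mem_coderivative_polyNormal_of_linearIndependent hx hli hl hv hw ⟨0, by simp⟩

theorem coderivative_polyNormal_eq_of_linearIndependent {x v w : Euc n} (hx : x ∈ polyhedron a c)
    (hli : LinearIndependent ℝ (fun j : {j // j ∈ activeIdx a c x} => a j))
    (hw : w ∈ domCoderivative (polyNormal a c) x v) :
    coderivative (polyNormal a c) x v w = multiplierSums a c x w := by
  obtain ⟨l, hl, hv, hlw⟩ := exists_multipliers_of_mem_domCoderivative hw
  exact Subset.antisymm (fun y => coderivative_polyNormal_subset)
    fun y => mem_coderivative_polyNormal_of_linearIndependent hx hli hl hv hlw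

theorem domCoderivative_truncNormal {x v : Euc n} {M : ℝ} (hM : ‖v‖ < M) :
    domCoderivative (truncNormal a c M) x v = domCoderivative (polyNormal a c) x v := by
  have hE : FiniteDimensional ℝ (WithLp 2 (Euc n × Euc n)) :=
    (WithLp.linearEquiv 2 ℝ (Euc n × Euc n)).symm.finiteDimensional
  have hP : ProperSpace (WithLp 2 (Euc n × Euc n)) := FiniteDimensional.proper ℝ _
  have hsnd := WithLp.continuous_snd 2 (Euc n) (Euc n)
  have hcl : IsClosed (gph (truncNormal a c M)) :=
    isClosed_gph_polyNormal.inter (Metric.isClosed_closedBall.preimage hsnd)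
  have hev : ∀ᶠ q in 𝓝 (WithLp.toLp 2 (x, v)),
      q ∈ gph (truncNormal a c M) ↔ q ∈ gph (polyNormal a c) := by
    have : ∀ᶠ q in 𝓝 (WithLp.toLp 2 (x, v)), q.snd ∈ Metric.ball (0 : Euc n) M :=
      hsnd.continuousAt.eventually_mem (Metric.isOpen_ball.mem_nhds (by simpa using hM))
    filter_upwards [this] with q hq
    exact ⟨fun h => h.1, fun h => ⟨h, Metric.ball_subset_closedBall hq⟩⟩
  have heq : limitingNormalCone (gph (truncNormal a c M)) (WithLp.toLp 2 (x, v)) =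
      limitingNormalCone (gph (polyNormal a c)) (WithLp.toLp 2 (x, v)) :=
    Subset.antisymm (limitingNormalCone_subset_of_eventuallyEq hev isClosed_gph_polyNormal)
      (limitingNormalCone_subset_of_eventuallyEq (hev.mono fun _ h => h.symm) hcl)
  simp only [domCoderivative, coderivative, heq]

end LICQ

/-! ### Decoupling a Lipschitz function from a graph constraint. -/

theorem continuousOn_of_norm_sub_le {E F : Type*} [TopologicalSpace E] [NormedAddCommGroup F]
    {f : E → F} {S : Set E} {β : E → E → ℝ} (hβ : ∀ q, Continuous fun p => β p q)
    (hβ0 : ∀ q, β q q = 0) (h : ∀ p ∈ S, ∀ q ∈ S, ‖f p - f q‖ ≤ β p q) : ContinuousOn f S := by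
  intro q hq
  refine tendsto_iff_norm_sub_tendsto_zero.2 ?_
  have hl : Tendsto (fun p => β p q) (𝓝[S] q) (𝓝 0) := by
    simpa [hβ0] using ((hβ q).tendsto q).mono_left nhdsWithin_le_nhds
  refine squeeze_zero' (Eventually.of_forall fun _ => norm_nonneg _) ?_ hl
  filter_upwards [self_mem_nhdsWithin] with p hp using h p hp q hq

section Decoupling

variable {X Y : Type*} [NormedAddCommGroup X] [InnerProductSpace ℝ X]
  [NormedAddCommGroup Y] [InnerProductSpace ℝ Y]

/-- A decoupling principle: an approximate local minimum of `f + ⟨w, ·⟩ - ⟨z, ·⟩` over the graph of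
`G` produces an approximate subgradient of `f` and an approximate normal to the graph of `G`. -/
theorem exists_decoupling [ProperSpace X] [ProperSpace Y] {f : X → Y → ℝ} {G : X → Set X}
    (hG : IsClosed {p : X × X | p.2 ∈ G p.1}) {x₀ v₀ zx w : X} {u₀ zu : Y} {r ε L η : ℝ}
    (hr : 0 < r) (hε : 0 < ε) (hL : 0 ≤ L) (hη : 0 < η) (hηr : η ≤ r)
    (hf : ∀ a a' b b', ‖a - x₀‖ ≤ r → ‖a' - x₀‖ ≤ r → ‖b - u₀‖ ≤ r → ‖b' - u₀‖ ≤ r →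
      |f a b - f a' b'| ≤ L * (‖a - a'‖ + ‖b - b'‖))
    (hv₀ : v₀ ∈ G x₀)
    (H : ∀ y b v, v ∈ G y → ‖y - x₀‖ ≤ r → ‖b - u₀‖ ≤ r → ‖v - v₀‖ ≤ r →
      inner ℝ zx (y - x₀) + inner ℝ zu (b - u₀) - inner ℝ w (v - v₀) - (f y b - f x₀ u₀) ≤
        ε * (‖y - x₀‖ + ‖b - u₀‖ + ‖v - v₀‖)) :
    ∃ a b y v ξ, v ∈ G y ∧ ‖a - x₀‖ < η ∧ ‖b - u₀‖ < η ∧ ‖y - x₀‖ < η ∧ ‖v - v₀‖ < η ∧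
      ‖ξ‖ ≤ 2 * L ∧
      (∃ δ > 0, ∀ a' b', ‖a' - a‖ < δ → ‖b' - b‖ < δ →
        inner ℝ zu (b' - b) - inner ℝ ξ (a' - a) ≤
          f a' b' - f a b + 3 * ε * (‖a' - a‖ + ‖b' - b‖)) ∧
      ∃ δ > 0, ∀ y' v', v' ∈ G y' → ‖y' - y‖ < δ → ‖v' - v‖ < δ →
        inner ℝ (zx + ξ) (y' - y) - inner ℝ w (v' - v) ≤ 3 * ε * (‖y' - y‖ + ‖v' - v‖) := by
  -- The first bound on the penalty weight forces `‖a - y‖ < η / 2`, the second keeps `y`, `b`, `v`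
  -- within `η / 2` of the base point.
  obtain ⟨m, hm, hm1, hm2⟩ : ∃ m > 0, L < m * (η / 2) ∧ L * L < m * (ε * (η / 2)) := by
    refine ⟨2 * (L + L ^ 2 / ε + 1) / η, by positivity, ?_, ?_⟩
    · have : 2 * (L + L ^ 2 / ε + 1) / η * (η / 2) = L + L ^ 2 / ε + 1 := by field_simp
      rw [this]
      have : 0 ≤ L ^ 2 / ε := by positivity
      linarith
    · have : 2 * (L + L ^ 2 / ε + 1) / η * (ε * (η / 2)) = L * ε + L ^ 2 + ε := by field_simp
      rw [this]
      nlinarith [mul_nonneg hL hε.le]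
  -- The variable `x` is doubled: `a` enters `f` and `y` enters `G`. The weight `2ε` exceeds the `ε`
  -- in `H`, and the surplus localizes the minimizer. The variable `b` needs no copy, as `G` does
  -- not depend on it.
  let Φ : X × Y × X × X → ℝ := fun q => f q.1 q.2.1 - inner ℝ zx q.2.2.1 - inner ℝ zu q.2.1 +
    inner ℝ w q.2.2.2 + m * ‖q.1 - q.2.2.1‖ ^ 2 +
    2 * ε * (‖q.2.2.1 - x₀‖ + ‖q.2.1 - u₀‖ + ‖q.2.2.2 - v₀‖)
  let S : Set (X × Y × X × X) := Metric.closedBall x₀ r ×ˢ Metric.closedBall u₀ r ×ˢ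
    ((Metric.closedBall x₀ r ×ˢ Metric.closedBall v₀ r) ∩ {p : X × X | p.2 ∈ G p.1})
  have hScomp : IsCompact S := (isCompact_closedBall _ _).prod ((isCompact_closedBall _ _).prod
    (((isCompact_closedBall _ _).prod (isCompact_closedBall _ _)).inter_right hG))
  have hbase : (x₀, u₀, x₀, v₀) ∈ S := by simp [S, hr.le, hv₀]
  have hΦ : ContinuousOn Φ S := by
    have hfc : ContinuousOn (fun q : X × Y × X × X => f q.1 q.2.1) S := by
      exact continuousOn_of_norm_sub_le (β := fun p q => L * (‖p.1 - q.1‖ + ‖p.2.1 - q.2.1‖))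
        (fun q => by fun_prop) (fun q => by simp) fun p hp q hq =>
        hf _ _ _ _ (mem_closedBall_iff_norm.1 hp.1) (mem_closedBall_iff_norm.1 hq.1)
          (mem_closedBall_iff_norm.1 hp.2.1) (mem_closedBall_iff_norm.1 hq.2.1)
    refine ContinuousOn.add (ContinuousOn.add (ContinuousOn.add (ContinuousOn.sub
      (ContinuousOn.sub hfc ?_) ?_) ?_) ?_) ?_ <;>
    exact Continuous.continuousOn (by fun_prop)
  obtain ⟨⟨a, b, y, v⟩, hq, hmin⟩ := hScomp.exists_isMinOn ⟨_, hbase⟩ hΦ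
  have hmin : ∀ a' b' y' v', ‖a' - x₀‖ ≤ r → ‖b' - u₀‖ ≤ r → ‖y' - x₀‖ ≤ r → ‖v' - v₀‖ ≤ r →
      v' ∈ G y' → Φ (a, b, y, v) ≤ Φ (a', b', y', v') := fun a' b' y' v' h1 h2 h3 h4 h5 =>
    hmin ⟨mem_closedBall_iff_norm.2 h1, mem_closedBall_iff_norm.2 h2,
      ⟨mem_closedBall_iff_norm.2 h3, mem_closedBall_iff_norm.2 h4⟩, h5⟩
  obtain ⟨ha, hb, ⟨hy, hv⟩, hvG⟩ := hq
  rw [mem_closedBall_iff_norm] at ha hb hy hv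
  simp only at ha hb hy hv
  change v ∈ G y at hvG
  simp only [Φ] at hmin
  have h0 := hmin x₀ u₀ x₀ v₀ (by simpa using hr.le) (by simpa using hr.le) (by simpa using hr.le)
    (by simpa using hr.le) hv₀
  have h1 := H y b v hvG hy hb hv
  have h2 := (neg_le_abs _).trans (hf a y b b ha hy hb hb)
  simp only [sub_self, norm_zero, add_zero, mul_zero, inner_sub_right] at h0 h1 h2
  have hs0 := norm_nonneg (a - y)
  have hy0 := norm_nonneg (y - x₀)
  have hb0 := norm_nonneg (b - u₀)
  have hv0 := norm_nonneg (v - v₀)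
  -- Minimality against the base point, `H` at `(y, b, v)`, and the Lipschitz cost of replacing `a`
  -- by `y` in `f`.
  have hmain : m * ‖a - y‖ ^ 2 + ε * (‖y - x₀‖ + ‖b - u₀‖ + ‖v - v₀‖) ≤ L * ‖a - y‖ := by
    linarith
  have hms : m * ‖a - y‖ ≤ L := by
    rcases hs0.eq_or_lt with h | h
    · rw [← h, mul_zero]; exact hL
    · refine le_of_mul_le_mul_right ?_ h
      have : 0 ≤ ε * (‖y - x₀‖ + ‖b - u₀‖ + ‖v - v₀‖) := by positivity
      nlinarith
  have hs : ‖a - y‖ < η / 2 := lt_of_mul_lt_mul_left (hms.trans_lt hm1) hm.le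
  have hN : ‖y - x₀‖ + ‖b - u₀‖ + ‖v - v₀‖ < η / 2 := by
    have h3 : m * (ε * (‖y - x₀‖ + ‖b - u₀‖ + ‖v - v₀‖)) ≤ L * L := by
      have h4 : 0 ≤ m * ‖a - y‖ ^ 2 := by positivity
      calc m * (ε * (‖y - x₀‖ + ‖b - u₀‖ + ‖v - v₀‖)) ≤ m * (L * ‖a - y‖) := by
            refine mul_le_mul_of_nonneg_left ?_ hm.le; linarith
        _ = L * (m * ‖a - y‖) := by ring
        _ ≤ L * L := by gcongr
    exact lt_of_mul_lt_mul_left (lt_of_mul_lt_mul_left (h3.trans_lt hm2) hm.le) hε.le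
  have haη : ‖a - x₀‖ < η := by
    have := norm_sub_le_norm_sub_add_norm_sub a y x₀
    linarith
  have hquad : ∀ {E : Type _} [NormedAddCommGroup E] (h : E), ‖h‖ < ε / m →
      m * ‖h‖ ^ 2 ≤ ε * ‖h‖ := fun h hh => by
    rw [lt_div_iff₀ hm] at hh
    nlinarith [norm_nonneg h]
  -- `ξ` is the gradient of the penalty in `a`. The radii stay in the balls of minimality and make
  -- the quadratic remainder at most `ε ‖h‖`; with the `2ε` terms of `Φ` this gives `3ε`.
  refine ⟨a, b, y, v, (2 * m) • (a - y), hvG, haη, by linarith, by linarith, by linarith, ?_,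
    ⟨min (min (r - ‖a - x₀‖) (r - ‖b - u₀‖)) (ε / m), ?_, fun a' b' ha' hb' => ?_⟩,
    ⟨min (min (r - ‖y - x₀‖) (r - ‖v - v₀‖)) (ε / m), ?_, fun y' v' hv' hy' hvv' => ?_⟩⟩
  · rw [norm_smul, Real.norm_of_nonneg (by positivity)]
    linarith
  · exact lt_min (lt_min (by linarith) (by linarith)) (by positivity)
  · simp only [lt_min_iff] at ha' hb'
    have t1 := norm_sub_le_norm_sub_add_norm_sub a' a x₀
    have t2 := norm_sub_le_norm_sub_add_norm_sub b' b u₀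
    have h3 := hmin a' b' y v (by linarith) (by linarith) hy hv hvG
    have h4 : ‖a' - y‖ ^ 2 = ‖a - y‖ ^ 2 + 2 * inner ℝ (a - y) (a' - a) + ‖a' - a‖ ^ 2 := by
      rw [← norm_add_sq_real]; congr 2; abel
    have h5 := hquad (a' - a) ha'.2
    rw [h4] at h3
    rw [inner_smul_left, inner_sub_right zu]
    simp only [conj_trivial]
    have h6 : ε * ‖b' - u₀‖ ≤ ε * (‖b' - b‖ + ‖b - u₀‖) := by gcongr
    have h7 : 0 ≤ ε * ‖a' - a‖ := by positivity
    have h8 : 0 ≤ ε * ‖b' - b‖ := by positivity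
    linarith
  · exact lt_min (lt_min (by linarith) (by linarith)) (by positivity)
  · simp only [lt_min_iff] at hy' hvv'
    have t1 := norm_sub_le_norm_sub_add_norm_sub y' y x₀
    have t2 := norm_sub_le_norm_sub_add_norm_sub v' v v₀
    have h3 := hmin a b y' v' ha hb (by linarith) (by linarith) hv'
    have h4 : ‖a - y'‖ ^ 2 = ‖a - y‖ ^ 2 - 2 * inner ℝ (a - y) (y' - y) + ‖y' - y‖ ^ 2 := by
      rw [← norm_sub_sq_real]; congr 2; abel
    have h5 := hquad (y' - y) hy'.2
    rw [h4] at h3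
    rw [inner_add_left, inner_smul_left, inner_sub_right zx, inner_sub_right w]
    simp only [conj_trivial]
    have h6 : ε * ‖y' - x₀‖ ≤ ε * (‖y' - y‖ + ‖y - x₀‖) := by gcongr
    have h7 : ε * ‖v' - v₀‖ ≤ ε * (‖v' - v‖ + ‖v - v₀‖) := by gcongr
    have h8 : 0 ≤ ε * ‖v' - v‖ := by positivity
    linarith

/-- Removes the dependence of `ξ` on `ε`; `P` is kept at points near `ξ₀`, as it need not pass to
the limit. -/
theorem exists_cluster_of_forall_exists {X : Type*} [NormedAddCommGroup X] {K : Set X}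
    (hK : IsCompact K) (P : ℝ → X → Prop)
    (hP : ∀ ε ε' ξ, ε ≤ ε' → P ε ξ → P ε' ξ) (h : ∀ ε > 0, ∃ ξ ∈ K, P ε ξ) :
    ∃ ξ₀, ∀ ε > 0, ∃ ξ, ‖ξ - ξ₀‖ < ε ∧ P ε ξ := by
  have hpos : ∀ k : ℕ, (0 : ℝ) < 1 / ((k : ℝ) + 1) := fun k => Nat.one_div_pos_of_nat
  choose ξ hξK hξ using fun k : ℕ => h _ (hpos k)
  obtain ⟨ξ₀, -, φ, hφ, hlim⟩ := hK.tendsto_subseq hξK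
  refine ⟨ξ₀, fun ε hε => ?_⟩
  have h1 := (Metric.tendsto_nhds.1 hlim) ε hε
  have h2 := (tendsto_one_div_add_atTop_nhds_zero_nat (𝕜 := ℝ)).comp hφ.tendsto_atTop
  obtain ⟨k, hk1, hk2⟩ := (h1.and (h2.eventually_lt_const hε)).exists
  exact ⟨ξ (φ k), by simpa [dist_eq_norm] using hk1, hP _ _ _ hk2.le (hξ _)⟩

theorem mem_limitingSubdifferential_of_forall [FiniteDimensional ℝ X] {φ : X → ℝ} {x v : X}
    {ρ : ℝ} (hρ : 0 < ρ) (hφ : ContinuousOn φ (Metric.closedBall x ρ))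
    (H : ∀ ε > 0, ∃ x', ‖x' - x‖ < ε ∧ ∃ δ > 0, ∀ x'', ‖x'' - x'‖ < δ →
      inner ℝ v (x'' - x') ≤ φ x'' - φ x' + ε * ‖x'' - x'‖) :
    v ∈ limitingSubdifferential φ x := by
  -- The subdifferential is the coderivative of the epigraphical mapping in direction 1. Continuity
  -- of `φ` supplies local closedness and lets the nearby graph points be taken as `(x', φ x')`.
  change v ∈ coderivative (fun p => {t | φ p ≤ t}) x (φ x) 1
  refine mem_coderivative_of_forall (le_refl (φ x)) hρ ?_ fun ε hε => ?_
  · have hfst := WithLp.continuous_fst 2 X ℝ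
    have hsnd := WithLp.continuous_snd 2 X ℝ
    set B := Metric.closedBall (WithLp.toLp 2 (x, φ x)) ρ
    have hmaps : MapsTo (fun q : WithLp 2 (X × ℝ) => q.fst) B (Metric.closedBall x ρ) := by
      intro q hq
      rw [mem_closedBall_iff_norm] at hq ⊢
      exact (norm_fst_le_toLp (q - WithLp.toLp 2 (x, φ x))).trans hq
    have hc : ContinuousOn (fun q : WithLp 2 (X × ℝ) => q.snd - φ q.fst) B :=
      hsnd.continuousOn.sub (hφ.comp hfst.continuousOn hmaps)
    convert hc.preimage_isClosed_of_isClosed Metric.isClosed_closedBall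
      (isClosed_Ici : IsClosed (Ici (0 : ℝ))) using 1
    ext q
    simp [gph, and_comm]
  · have hcx : ContinuousAt φ x := hφ.continuousAt (Metric.closedBall_mem_nhds x hρ)
    obtain ⟨η, hη, hcx⟩ := Metric.continuousAt_iff.1 hcx ε hε
    obtain ⟨x', hx', δ, hδ, h⟩ := H (min ε η) (by positivity)
    rw [lt_min_iff] at hx'
    refine ⟨x', φ x', le_refl (φ x'), hx'.1, ?_, δ, hδ, fun x'' t ht hx'' _ => ?_⟩
    · simpa [dist_eq_norm] using hcx (by simpa [dist_eq_norm] using hx'.2)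
    · have h1 := h x'' hx''
      have h2 : min ε η * ‖x'' - x'‖ ≤ ε * ‖x'' - x'‖ := by gcongr; exact min_le_left _ _
      have h3 : (inner ℝ (1 : ℝ) (t - φ x') : ℝ) = t - φ x' := by simp
      have h4 : 0 ≤ ε * ‖t - φ x'‖ := by positivity
      have h5 : φ x'' ≤ t := ht
      rw [h3]
      linarith

end Decoupling

/-! ### Straightening the graph of the sweeping mapping. -/

section SweepingMap

variable {n d s : ℕ} {a : Fin s → Euc n} {c : Fin s → ℝ} {g : Euc n → Euc d → Euc n}

theorem LipschitzAround.exists_bound {x : Euc n} {u : Euc d} (h : LipschitzAround g x u) :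
    ∃ K ρ : ℝ, 0 ≤ K ∧ 0 < ρ ∧ ∀ y y' b b', ‖y - x‖ ≤ ρ → ‖y' - x‖ ≤ ρ → ‖b - u‖ ≤ ρ →
      ‖b' - u‖ ≤ ρ → ‖g y b - g y' b'‖ ≤ K * (‖y - y'‖ + ‖b - b'‖) := by
  obtain ⟨K, t, ht, hK⟩ := h
  obtain ⟨ρ, hρ, hsub⟩ := Metric.nhds_basis_closedBall.mem_iff.1 ht
  rw [← closedBall_prod_same] at hsub
  refine ⟨K, ρ, K.2, hρ, fun y y' b b' h1 h2 h3 h4 => ?_⟩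
  have := hK.dist_le_mul (y, b)
    (hsub ⟨mem_closedBall_iff_norm.2 h1, mem_closedBall_iff_norm.2 h3⟩) (y', b')
    (hsub ⟨mem_closedBall_iff_norm.2 h2, mem_closedBall_iff_norm.2 h4⟩)
  rw [dist_eq_norm, Prod.dist_eq, dist_eq_norm, dist_eq_norm] at this
  refine this.trans ?_
  gcongr
  exact max_le_add_of_nonneg (norm_nonneg _) (norm_nonneg _)

theorem mem_sweepingMap {p : WithLp 2 (Euc n × Euc d)} {ω : Euc n} :
    ω ∈ sweepingMap a c g p ↔ ω - g p.fst p.snd ∈ polyNormal a c p.fst := by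
  constructor
  · rintro ⟨v, hv, rfl⟩
    simpa using hv
  · exact fun h => ⟨_, h, by abel⟩

/-- The substitution `v = ω - g(x, u)` is locally Lipschitz in both directions, so `ε`-inequalities
survive it after rescaling `ε`. The converse is `mem_coderivative_sweepingMap_of_forall`. -/
theorem exists_of_mem_coderivative_sweepingMap {x : Euc n} {u : Euc d} {ω w : Euc n}
    {z : WithLp 2 (Euc n × Euc d)} (hg : LipschitzAround g x u)
    (hz : z ∈ coderivative (sweepingMap a c g) (WithLp.toLp 2 (x, u)) ω w) {ε : ℝ} (hε : 0 < ε) :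
    ∃ x' u' v', v' ∈ polyNormal a c x' ∧ ‖x' - x‖ < ε ∧ ‖u' - u‖ < ε ∧ ‖v' - (ω - g x u)‖ < ε ∧
      ∃ δ > 0, ∀ y b v, v ∈ polyNormal a c y → ‖y - x'‖ < δ → ‖b - u'‖ < δ → ‖v - v'‖ < δ →
        inner ℝ z.fst (y - x') + inner ℝ z.snd (b - u') - inner ℝ w (v - v') -
          inner ℝ w (g y b - g x' u') ≤ ε * (‖y - x'‖ + ‖b - u'‖ + ‖v - v'‖) := by
  obtain ⟨K, ρ, hK, hρ, hgK⟩ := hg.exists_bound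
  -- `2 r' ≤ ρ` keeps two successive displacements in the Lipschitz ball; the factor `1 + 2K` pays
  -- for the change of `g` in two arguments.
  have scale : ∀ r > 0, ∃ r' > 0, 2 * r' ≤ ρ ∧ (1 + 2 * K) * r' ≤ r := fun r hr => by
    refine ⟨min (ρ / 2) (r / (1 + 2 * K)), by positivity, ?_, ?_⟩
    · linarith [min_le_left (ρ / 2) (r / (1 + 2 * K))]
    · rw [← le_div_iff₀' (by positivity)]
      exact min_le_right _ _
  obtain ⟨ε', hε', hερ, hεε⟩ := scale ε hε
  obtain ⟨p, ω', hω', hp, hωω, δ, hδ, H⟩ := exists_of_mem_coderivative hz hε'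
  rw [mem_sweepingMap] at hω'
  obtain ⟨δ', hδ', hδρ, hδδ⟩ := scale (δ / 2) (by positivity)
  have hp1 := (norm_fst_le_toLp (p - WithLp.toLp 2 (x, u))).trans_lt hp
  have hp2 := (norm_snd_le_toLp (p - WithLp.toLp 2 (x, u))).trans_lt hp
  change ‖p.fst - x‖ < _ at hp1
  change ‖p.snd - u‖ < _ at hp2
  have hKε : 0 ≤ K * ε' := by positivity
  have hKδ : 0 ≤ K * δ' := by positivity
  refine ⟨p.fst, p.snd, ω' - g p.fst p.snd, hω', by linarith, by linarith, ?_,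
    δ', hδ', fun y b v hv hy hb hvv => ?_⟩
  · have hgg := hgK p.fst x p.snd u (by linarith) (by simpa using hρ.le) (by linarith)
      (by simpa using hρ.le)
    have e : ω' - g p.fst p.snd - (ω - g x u) = (ω' - ω) - (g p.fst p.snd - g x u) := by abel
    have n := norm_sub_le (ω' - ω) (g p.fst p.snd - g x u)
    have h : K * (‖p.fst - x‖ + ‖p.snd - u‖) ≤ K * (ε' + ε') := by gcongr
    rw [e]
    linarith
  · have t1 := norm_sub_le_norm_sub_add_norm_sub y p.fst x
    have t2 := norm_sub_le_norm_sub_add_norm_sub b p.snd u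
    have hgg := hgK y p.fst b p.snd (by linarith) (by linarith) (by linarith) (by linarith)
    have hmem : v + g y b ∈ sweepingMap a c g (WithLp.toLp 2 (y, b)) := ⟨v, hv, rfl⟩
    have e1 : WithLp.toLp 2 (y, b) - p = WithLp.toLp 2 (y - p.fst, b - p.snd) := rfl
    have n1 := toLp_norm_le_add (y - p.fst) (b - p.snd)
    have e2 : v + g y b - ω' = (v - (ω' - g p.fst p.snd)) + (g y b - g p.fst p.snd) := by abel
    have n2 := norm_add_le (v - (ω' - g p.fst p.snd)) (g y b - g p.fst p.snd)
    have hK2 : K * (‖y - p.fst‖ + ‖b - p.snd‖) ≤ K * (δ' + δ') := by gcongr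
    have := H (WithLp.toLp 2 (y, b)) (v + g y b) hmem (by rw [e1]; linarith)
      (by rw [e2]; linarith)
    rw [e1, e2, WithLp.prod_inner_apply, inner_add_right w] at this
    change inner ℝ z.fst (y - p.fst) + inner ℝ z.snd (b - p.snd) - _ ≤ _ at this
    have hfin : ε' * (‖WithLp.toLp 2 (y - p.fst, b - p.snd)‖ +
        ‖v - (ω' - g p.fst p.snd) + (g y b - g p.fst p.snd)‖) ≤
        ε * (‖y - p.fst‖ + ‖b - p.snd‖ + ‖v - (ω' - g p.fst p.snd)‖) := by
      calc _ ≤ ε' * ((1 + 2 * K) * (‖y - p.fst‖ + ‖b - p.snd‖ + ‖v - (ω' - g p.fst p.snd)‖)) := by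
            refine mul_le_mul_of_nonneg_left ?_ hε'.le
            have h1 : 0 ≤ K * (‖y - p.fst‖ + ‖b - p.snd‖) := by positivity
            have h2 : 0 ≤ K * ‖v - (ω' - g p.fst p.snd)‖ := by positivity
            linarith
        _ = (1 + 2 * K) * ε' * (‖y - p.fst‖ + ‖b - p.snd‖ + ‖v - (ω' - g p.fst p.snd)‖) := by ring
        _ ≤ _ := by gcongr
    linarith

theorem mem_coderivative_sweepingMap_of_forall {x : Euc n} {u : Euc d} {ω w : Euc n}
    {z : WithLp 2 (Euc n × Euc d)} (hg : LipschitzAround g x u)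
    (hω : ω ∈ sweepingMap a c g (WithLp.toLp 2 (x, u)))
    (H : ∀ ε > 0, ∃ x' u' v', v' ∈ polyNormal a c x' ∧ ‖x' - x‖ < ε ∧ ‖u' - u‖ < ε ∧
      ‖v' - (ω - g x u)‖ < ε ∧ ∃ δ > 0, ∀ y b v, v ∈ polyNormal a c y →
        ‖y - x'‖ < δ → ‖b - u'‖ < δ → ‖v - v'‖ < δ →
        inner ℝ z.fst (y - x') + inner ℝ z.snd (b - u') - inner ℝ w (v - v') -
          inner ℝ w (g y b - g x' u') ≤ ε * (‖y - x'‖ + ‖b - u'‖ + ‖v - v'‖)) :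
    z ∈ coderivative (sweepingMap a c g) (WithLp.toLp 2 (x, u)) ω w := by
  obtain ⟨K, ρ, hK, hρ, hgK⟩ := hg.exists_bound
  have : FiniteDimensional ℝ (WithLp 2 (Euc n × Euc d)) :=
    (WithLp.linearEquiv 2 ℝ (Euc n × Euc d)).symm.finiteDimensional
  refine mem_coderivative_of_forall hω hρ ?_ fun ε hε => ?_
  · set B := Metric.closedBall (WithLp.toLp 2 (WithLp.toLp 2 (x, u), ω)) ρ
    have hc1 := WithLp.continuous_fst 2 (WithLp 2 (Euc n × Euc d)) (Euc n)
    have hc2 := WithLp.continuous_snd 2 (WithLp 2 (Euc n × Euc d)) (Euc n)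
    have hc3 := (WithLp.continuous_fst 2 (Euc n) (Euc d)).comp hc1
    have hc4 := (WithLp.continuous_snd 2 (Euc n) (Euc d)).comp hc1
    have hB : ∀ q ∈ B, ‖q.fst.fst - x‖ ≤ ρ ∧ ‖q.fst.snd - u‖ ≤ ρ := fun q hq => by
      rw [mem_closedBall_iff_norm] at hq
      have h := (norm_fst_le_toLp (q - WithLp.toLp 2 (WithLp.toLp 2 (x, u), ω))).trans hq
      exact ⟨(norm_fst_le_toLp (q.fst - WithLp.toLp 2 (x, u))).trans h,
        (norm_snd_le_toLp (q.fst - WithLp.toLp 2 (x, u))).trans h⟩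
    have hgc : ContinuousOn
        (fun q : WithLp 2 (WithLp 2 (Euc n × Euc d) × Euc n) => g q.fst.fst q.fst.snd) B := by
      exact continuousOn_of_norm_sub_le
        (β := fun p q => K * (‖p.fst.fst - q.fst.fst‖ + ‖p.fst.snd - q.fst.snd‖))
        (fun q => continuous_const.mul
          ((hc3.sub continuous_const).norm.add (hc4.sub continuous_const).norm))
        (fun q => by simp) fun p hp q hq =>
        hgK _ _ _ _ (hB p hp).1 (hB q hq).1 (hB p hp).2 (hB q hq).2
    have hc : ContinuousOn (fun q : WithLp 2 (WithLp 2 (Euc n × Euc d) × Euc n) =>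
        WithLp.toLp 2 (q.fst.fst, q.snd - g q.fst.fst q.fst.snd)) B :=
      (WithLp.prod_continuous_toLp 2 _ _).comp_continuousOn
        (hc3.continuousOn.prodMk (hc2.continuousOn.sub hgc))
    convert hc.preimage_isClosed_of_isClosed Metric.isClosed_closedBall
      (isClosed_gph_polyNormal (a := a) (c := c)) using 1
    ext q
    rw [inter_comm]
    exact and_congr_right fun _ => mem_sweepingMap
  · obtain ⟨ε', hε', hερ, hεε⟩ : ∃ r' > 0, 2 * r' ≤ ρ ∧ (2 + 2 * K) * r' ≤ ε := by
      refine ⟨min (ρ / 2) (ε / (2 + 2 * K)), by positivity, ?_, ?_⟩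
      · linarith [min_le_left (ρ / 2) (ε / (2 + 2 * K))]
      · rw [← le_div_iff₀' (by positivity)]
        exact min_le_right _ _
    obtain ⟨x', u', v', hv', hx, hu, hv, δ, hδ, H⟩ := H ε' hε'
    obtain ⟨δ', hδ', hδρ, hδδ⟩ : ∃ r' > 0, 2 * r' ≤ ρ ∧ (1 + 2 * K) * r' ≤ δ / 2 := by
      refine ⟨min (ρ / 2) ((δ / 2) / (1 + 2 * K)), by positivity, ?_, ?_⟩
      · linarith [min_le_left (ρ / 2) ((δ / 2) / (1 + 2 * K))]
      · rw [← le_div_iff₀' (by positivity)]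
        exact min_le_right _ _
    have hKε : 0 ≤ K * ε' := by positivity
    have hKδ : 0 ≤ K * δ' := by positivity
    refine ⟨WithLp.toLp 2 (x', u'), v' + g x' u', ⟨v', hv', rfl⟩, ?_, ?_, δ', hδ',
      fun p ω'' hω'' hp hωd => ?_⟩
    · have n1 := toLp_norm_le_add (x' - x) (u' - u)
      change ‖WithLp.toLp 2 (x' - x, u' - u)‖ < ε
      linarith
    · have hgg := hgK x' x u' u (by linarith) (by simpa using hρ.le) (by linarith)
        (by simpa using hρ.le)
      have e : v' + g x' u' - ω = (v' - (ω - g x u)) + (g x' u' - g x u) := by abel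
      have n := norm_add_le (v' - (ω - g x u)) (g x' u' - g x u)
      have h : K * (‖x' - x‖ + ‖u' - u‖) ≤ K * (ε' + ε') := by gcongr
      rw [e]
      linarith
    · rw [mem_sweepingMap] at hω''
      have hp1 := norm_fst_le_toLp (p - WithLp.toLp 2 (x', u'))
      have hp2 := norm_snd_le_toLp (p - WithLp.toLp 2 (x', u'))
      change ‖p.fst - x'‖ ≤ _ at hp1
      change ‖p.snd - u'‖ ≤ _ at hp2
      have t1 := norm_sub_le_norm_sub_add_norm_sub p.fst x' x
      have t2 := norm_sub_le_norm_sub_add_norm_sub p.snd u' u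
      have hgg := hgK p.fst x' p.snd u' (by linarith) (by linarith) (by linarith) (by linarith)
      have e : ω'' - g p.fst p.snd - v' =
          (ω'' - (v' + g x' u')) - (g p.fst p.snd - g x' u') := by abel
      have n := norm_sub_le (ω'' - (v' + g x' u')) (g p.fst p.snd - g x' u')
      have hK2 : K * (‖p.fst - x'‖ + ‖p.snd - u'‖) ≤ K * (δ' + δ') := by
        refine mul_le_mul_of_nonneg_left ?_ hK; linarith
      have := H p.fst p.snd _ hω'' (by linarith) (by linarith) (by rw [e]; linarith)
      rw [e, inner_sub_right w] at this
      have e3 : inner ℝ z (p - WithLp.toLp 2 (x', u')) =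
          inner ℝ z.fst (p.fst - x') + inner ℝ z.snd (p.snd - u') := WithLp.prod_inner_apply _ _
      have hfin : ε' * (‖p.fst - x'‖ + ‖p.snd - u'‖ +
          ‖ω'' - (v' + g x' u') - (g p.fst p.snd - g x' u')‖) ≤
          ε * (‖p - WithLp.toLp 2 (x', u')‖ + ‖ω'' - (v' + g x' u')‖) := by
        have hK3 : K * (‖p.fst - x'‖ + ‖p.snd - u'‖) ≤
            K * (2 * ‖p - WithLp.toLp 2 (x', u')‖) := by
          refine mul_le_mul_of_nonneg_left ?_ hK; linarith
        calc _ ≤ ε' * ((2 + 2 * K) *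
              (‖p - WithLp.toLp 2 (x', u')‖ + ‖ω'' - (v' + g x' u')‖)) := by
              refine mul_le_mul_of_nonneg_left ?_ hε'.le
              have h2 : 0 ≤ K * ‖ω'' - (v' + g x' u')‖ := by positivity
              have h3 : 0 ≤ ‖ω'' - (v' + g x' u')‖ := by positivity
              linarith
          _ = (2 + 2 * K) * ε' * (‖p - WithLp.toLp 2 (x', u')‖ + ‖ω'' - (v' + g x' u')‖) := by ring
          _ ≤ _ := by gcongr
      rw [e3]
      linarith

end SweepingMap

/-! ### Sum rules for Lipschitz and for `C¹` perturbations. -/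

section SumRule

variable {n d s : ℕ} {a : Fin s → Euc n} {c : Fin s → ℝ} {g : Euc n → Euc d → Euc n}

theorem exists_subgradient_add_of_mem_coderivative {x : Euc n} {u : Euc d} {ω w : Euc n}
    {z : WithLp 2 (Euc n × Euc d)} (hg : LipschitzAround g x u)
    (hω : ω ∈ sweepingMap a c g (WithLp.toLp 2 (x, u)))
    (hz : z ∈ coderivative (sweepingMap a c g) (WithLp.toLp 2 (x, u)) ω w) :
    ∃ v ∈ limitingSubdifferential (scalarization g w) (WithLp.toLp 2 (x, u)),
      ∃ y ∈ coderivative (polyNormal a c) x (ω - g x u) w, z = v + WithLp.toLp 2 (y, 0) := by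
  obtain ⟨K, ρ, hK, hρ, hgK⟩ := hg.exists_bound
  have hfin : FiniteDimensional ℝ (WithLp 2 (Euc n × Euc d)) :=
    (WithLp.linearEquiv 2 ℝ (Euc n × Euc d)).symm.finiteDimensional
  have hfK : ∀ y y' b b', ‖y - x‖ ≤ ρ → ‖y' - x‖ ≤ ρ → ‖b - u‖ ≤ ρ → ‖b' - u‖ ≤ ρ →
      |inner ℝ w (g y b) - inner ℝ w (g y' b')| ≤ ‖w‖ * K * (‖y - y'‖ + ‖b - b'‖) := by
    intro y y' b b' h1 h2 h3 h4
    rw [← inner_sub_right, mul_assoc]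
    refine (abs_real_inner_le_norm _ _).trans ?_
    gcongr
    exact hgK _ _ _ _ h1 h2 h3 h4
  have hclosed : IsClosed {p : Euc n × Euc n | p.2 ∈ polyNormal a c p.1} :=
    isClosed_gph_polyNormal.preimage (WithLp.prod_continuous_toLp 2 _ _)
  -- The multipliers `ξ` from the decoupling stay in a fixed ball, since `⟨w, g⟩` has local
  -- Lipschitz constant `‖w‖ K`.
  obtain ⟨ξ₀, hξ₀⟩ := exists_cluster_of_forall_exists
    (isCompact_closedBall (0 : Euc n) (2 * (‖w‖ * K)))
    (fun ε ξ => ∃ p q y v, v ∈ polyNormal a c y ∧ ‖p - x‖ < ε ∧ ‖q - u‖ < ε ∧ ‖y - x‖ < ε ∧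
      ‖v - (ω - g x u)‖ < ε ∧
      (∃ δ > 0, ∀ p' q', ‖p' - p‖ < δ → ‖q' - q‖ < δ →
        inner ℝ z.snd (q' - q) - inner ℝ ξ (p' - p) ≤
          inner ℝ w (g p' q') - inner ℝ w (g p q) + ε * (‖p' - p‖ + ‖q' - q‖)) ∧
      ∃ δ > 0, ∀ y' v', v' ∈ polyNormal a c y' → ‖y' - y‖ < δ → ‖v' - v‖ < δ →
        inner ℝ (z.fst + ξ) (y' - y) - inner ℝ w (v' - v) ≤ ε * (‖y' - y‖ + ‖v' - v‖))
    (by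
      rintro ε ε' ξ hle ⟨p, q, y, v, hv, h1, h2, h3, h4, ⟨δ, hδ, h5⟩, δ', hδ', h6⟩
      refine ⟨p, q, y, v, hv, h1.trans_le hle, h2.trans_le hle, h3.trans_le hle, h4.trans_le hle,
        ⟨δ, hδ, fun p' q' hp hq => (h5 p' q' hp hq).trans (by gcongr)⟩,
        δ', hδ', fun y' v' hv hy hv' => (h6 y' v' hv hy hv').trans (by gcongr)⟩)
    (by
      intro ε hε
      obtain ⟨ε', hε', hε3, hερ⟩ : ∃ ε' > 0, 3 * ε' ≤ ε ∧ 2 * ε' ≤ ρ :=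
        ⟨min (ε / 3) (ρ / 2), by positivity, by linarith [min_le_left (ε / 3) (ρ / 2)],
          by linarith [min_le_right (ε / 3) (ρ / 2)]⟩
      obtain ⟨x', u', v', hv', hx, hu, hv, δ, hδ, H⟩ :=
        exists_of_mem_coderivative_sweepingMap hg hz hε'
      obtain ⟨r, hr, hrδ, hrε⟩ : ∃ r > 0, 2 * r ≤ δ ∧ r ≤ ε' :=
        ⟨min (δ / 2) ε', by positivity, by linarith [min_le_left (δ / 2) ε'], min_le_right _ _⟩
      have hball : ∀ y, ‖y - x'‖ ≤ r → ‖y - x‖ ≤ ρ := fun y hy => by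
        linarith [norm_sub_le_norm_sub_add_norm_sub y x' x]
      have hball' : ∀ b, ‖b - u'‖ ≤ r → ‖b - u‖ ≤ ρ := fun b hb => by
        linarith [norm_sub_le_norm_sub_add_norm_sub b u' u]
      obtain ⟨p, q, y, v, ξ, hvy, hp, hq, hy, hvv, hξ, ⟨δ₁, hδ₁, h1⟩, δ₂, hδ₂, h2⟩ :=
        exists_decoupling (f := fun y b => inner ℝ w (g y b)) (G := polyNormal a c) hclosed
          (zx := z.fst) (zu := z.snd) (w := w) (x₀ := x') (u₀ := u') (v₀ := v') (η := r) hr hε'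
          (show 0 ≤ ‖w‖ * K by positivity) hr le_rfl
          (fun p p' q q' h1 h2 h3 h4 => hfK _ _ _ _ (hball _ h1) (hball _ h2) (hball' _ h3)
            (hball' _ h4)) hv' (fun y b v hv h1 h2 h3 => by
              rw [← inner_sub_right w (g y b)]
              exact H y b v hv (by linarith) (by linarith) (by linarith))
      refine ⟨ξ, by simpa using hξ, p, q, y, v, hvy, ?_, ?_, ?_, ?_, ⟨δ₁, hδ₁, ?_⟩, δ₂, hδ₂, ?_⟩
      · linarith [norm_sub_le_norm_sub_add_norm_sub p x' x]
      · linarith [norm_sub_le_norm_sub_add_norm_sub q u' u]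
      · linarith [norm_sub_le_norm_sub_add_norm_sub y x' x]
      · linarith [norm_sub_le_norm_sub_add_norm_sub v v' (ω - g x u)]
      · exact fun p' q' hp' hq' => (h1 p' q' hp' hq').trans (by gcongr)
      · exact fun y' v' hv' hy' hvv' => (h2 y' v' hv' hy' hvv').trans (by gcongr))
  have hhalf : ∀ (ε : ℝ) (ξ h : Euc n), ‖ξ - ξ₀‖ < ε / 2 →
      |inner ℝ (ξ - ξ₀) h| ≤ ε / 2 * ‖h‖ := fun ε ξ h hξ =>
    (abs_real_inner_le_norm _ _).trans (by gcongr)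
  -- The splitting is `z = (-ξ₀, z_u) + (z_x + ξ₀, 0)`; replacing `ξ` by `ξ₀` costs a further
  -- multiple of `ε`.
  refine ⟨WithLp.toLp 2 (-ξ₀, z.snd), ?_, z.fst + ξ₀, ?_, ?_⟩
  · refine mem_limitingSubdifferential_of_forall hρ ?_ fun ε hε => ?_
    · have hc1 := WithLp.continuous_fst 2 (Euc n) (Euc d)
      have hc2 := WithLp.continuous_snd 2 (Euc n) (Euc d)
      refine continuousOn_of_norm_sub_le
        (β := fun p q => ‖w‖ * K * (‖p.fst - q.fst‖ + ‖p.snd - q.snd‖))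
        (fun q => continuous_const.mul
          ((hc1.sub continuous_const).norm.add (hc2.sub continuous_const).norm))
        (fun q => by simp) fun p hp q hq => ?_
      rw [mem_closedBall_iff_norm] at hp hq
      exact hfK _ _ _ _ ((norm_fst_le_toLp (p - WithLp.toLp 2 (x, u))).trans hp)
        ((norm_fst_le_toLp (q - WithLp.toLp 2 (x, u))).trans hq)
        ((norm_snd_le_toLp (p - WithLp.toLp 2 (x, u))).trans hp)
        ((norm_snd_le_toLp (q - WithLp.toLp 2 (x, u))).trans hq)
    · obtain ⟨ξ, hξ, p, q, -, -, -, hp, hq, -, -, ⟨δ, hδ, H⟩, -⟩ := hξ₀ (ε / 4) (by positivity)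
      refine ⟨WithLp.toLp 2 (p, q), ?_, δ, hδ, fun p' hp' => ?_⟩
      · have := toLp_norm_le_add (p - x) (q - u)
        change ‖WithLp.toLp 2 (p - x, q - u)‖ < ε
        linarith
      · have h1 := norm_fst_le_toLp (p' - WithLp.toLp 2 (p, q))
        have h2 := norm_snd_le_toLp (p' - WithLp.toLp 2 (p, q))
        change ‖p'.fst - p‖ ≤ _ at h1
        change ‖p'.snd - q‖ ≤ _ at h2
        have h3 := H p'.fst p'.snd (h1.trans_lt hp') (h2.trans_lt hp')
        have h4 := (le_abs_self _).trans (hhalf (ε / 2) ξ (p'.fst - p) (by linarith))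
        have e : inner ℝ (WithLp.toLp 2 (-ξ₀, z.snd)) (p' - WithLp.toLp 2 (p, q)) =
            inner ℝ (-ξ₀) (p'.fst - p) + inner ℝ z.snd (p'.snd - q) := WithLp.prod_inner_apply _ _
        have h5 : ε * ‖p'.fst - p‖ ≤ ε * ‖p' - WithLp.toLp 2 (p, q)‖ := by gcongr
        have h6 : ε * ‖p'.snd - q‖ ≤ ε * ‖p' - WithLp.toLp 2 (p, q)‖ := by gcongr
        have h7 : 0 ≤ ε * ‖p' - WithLp.toLp 2 (p, q)‖ := by positivity
        rw [e, inner_neg_left]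
        rw [inner_sub_left] at h4
        change _ ≤ inner ℝ w (g p'.fst p'.snd) - inner ℝ w (g p q) + _
        linarith
  · refine mem_coderivative_of_forall (mem_sweepingMap.1 hω) one_pos
      (isClosed_gph_polyNormal.inter Metric.isClosed_closedBall) fun ε hε => ?_
    obtain ⟨ξ, hξ, -, -, y, v, hv, -, -, hy, hvv, -, δ, hδ, H⟩ := hξ₀ (ε / 2) (by positivity)
    refine ⟨y, v, hv, by linarith, by linarith, δ, hδ, fun y' v' hv' hy' hvv' => ?_⟩
    have h1 := H y' v' hv' hy' hvv'
    have h2 := (neg_le_abs _).trans (hhalf ε ξ (y' - y) hξ)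
    rw [inner_add_left] at h1 ⊢
    rw [inner_sub_left] at h2
    have h3 : 0 ≤ ε * ‖v' - v‖ := by positivity
    linarith
  · have : WithLp.toLp 2 (-ξ₀, z.snd) + WithLp.toLp 2 (z.fst + ξ₀, (0 : Euc d)) =
        WithLp.toLp 2 (-ξ₀ + (z.fst + ξ₀), z.snd + 0) := rfl
    rw [this, add_zero, show -ξ₀ + (z.fst + ξ₀) = z.fst by abel]
    rfl

/-- A `C¹` map is strictly differentiable, so the linearization error is uniform over pairs of
points near `(x, u)`, not only increments from `(x, u)`. -/
theorem exists_adjointJacobian_bound {x : Euc n} {u : Euc d}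
    (hg : ContDiffAt ℝ 1 (Function.uncurry g) (x, u)) (w : Euc n) {η : ℝ} (hη : 0 < η) :
    ∃ ρ > 0, ∀ y y' b b', ‖y - x‖ < ρ → ‖y' - x‖ < ρ → ‖b - u‖ < ρ → ‖b' - u‖ < ρ →
      |inner ℝ w (g y b - g y' b') - inner ℝ (adjointJacobian g x u w).fst (y - y') -
        inner ℝ (adjointJacobian g x u w).snd (b - b')| ≤ η * (‖y - y'‖ + ‖b - b'‖) := by
  have hS := hg.hasStrictFDerivAt one_ne_zero
  set D := fderiv ℝ (Function.uncurry g) (x, u)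
  have hx : fderiv ℝ (fun y => g y u) x = D.comp (ContinuousLinearMap.inl ℝ (Euc n) (Euc d)) :=
    (HasFDerivAt.comp (g := Function.uncurry g) (f := fun y : Euc n => (y, u)) x
      hS.hasFDerivAt (hasFDerivAt_prodMk_left x u)).fderiv
  have hu : fderiv ℝ (fun v => g x v) u = D.comp (ContinuousLinearMap.inr ℝ (Euc n) (Euc d)) :=
    (HasFDerivAt.comp (g := Function.uncurry g) (f := fun v : Euc d => (x, v)) u
      hS.hasFDerivAt (hasFDerivAt_prodMk_right x u)).fderiv
  have hev := hS.isLittleO.def (show 0 < η / (‖w‖ + 1) by positivity)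
  obtain ⟨ρ, hρ, H⟩ := Metric.eventually_nhds_iff.1 hev
  refine ⟨ρ, hρ, fun y y' b b' hy hy' hb hb' => ?_⟩
  have h := @H ((y, b), (y', b')) (by
    rw [← dist_eq_norm] at hy hy' hb hb'
    exact max_lt (max_lt hy hb) (max_lt hy' hb'))
  have e : inner ℝ w (g y b - g y' b') - inner ℝ (adjointJacobian g x u w).fst (y - y') -
      inner ℝ (adjointJacobian g x u w).snd (b - b') =
      inner ℝ w (g y b - g y' b' - D (y - y', b - b')) := by
    have e1 : inner ℝ (adjointJacobian g x u w).fst (y - y') = inner ℝ w (D (y - y', 0)) := by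
      simp [adjointJacobian, hx, ContinuousLinearMap.adjoint_inner_left]
    have e2 : inner ℝ (adjointJacobian g x u w).snd (b - b') = inner ℝ w (D (0, b - b')) := by
      simp [adjointJacobian, hu, ContinuousLinearMap.adjoint_inner_left]
    have e3 : D (y - y', b - b') = D (y - y', 0) + D (0, b - b') := by
      rw [← map_add]; simp
    rw [e1, e2, e3, inner_sub_right w _ (_ + _), inner_add_right]
    ring
  rw [e]
  refine (abs_real_inner_le_norm _ _).trans ?_
  have h' : ‖g y b - g y' b' - D (y - y', b - b')‖ ≤
      η / (‖w‖ + 1) * (‖y - y'‖ + ‖b - b'‖) := by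
    refine h.trans ?_
    gcongr
    exact max_le_add_of_nonneg (norm_nonneg _) (norm_nonneg _)
  calc ‖w‖ * ‖g y b - g y' b' - D (y - y', b - b')‖
      ≤ (‖w‖ + 1) * (η / (‖w‖ + 1) * (‖y - y'‖ + ‖b - b'‖)) := by gcongr; linarith
    _ = η * (‖y - y'‖ + ‖b - b'‖) := by field_simp

/-- The increment of `⟨w, g⟩` equals the pairing with the adjoint Jacobian up to `ε`, so it can be
moved into `z` in both directions. -/
theorem mem_coderivative_sweepingMap_iff {x : Euc n} {u : Euc d} {ω w : Euc n}
    {z : WithLp 2 (Euc n × Euc d)} (hL : LipschitzAround g x u)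
    (hg : ContDiffAt ℝ 1 (Function.uncurry g) (x, u))
    (hω : ω ∈ sweepingMap a c g (WithLp.toLp 2 (x, u))) :
    z ∈ coderivative (sweepingMap a c g) (WithLp.toLp 2 (x, u)) ω w ↔
      ∃ y ∈ coderivative (polyNormal a c) x (ω - g x u) w,
        z = adjointJacobian g x u w + WithLp.toLp 2 (y, 0) := by
  set A := (adjointJacobian g x u w).fst with hA
  set B := (adjointJacobian g x u w).snd with hB
  constructor
  · intro hz
    have key : ∀ ε > 0, ∃ x' u' v', v' ∈ polyNormal a c x' ∧ ‖x' - x‖ < ε ∧ ‖u' - u‖ < ε ∧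
        ‖v' - (ω - g x u)‖ < ε ∧ ∃ δ > 0, ∀ y b v, v ∈ polyNormal a c y →
          ‖y - x'‖ < δ → ‖b - u'‖ < δ → ‖v - v'‖ < δ →
          inner ℝ (z.fst - A) (y - x') + inner ℝ (z.snd - B) (b - u') - inner ℝ w (v - v') ≤
            ε * (‖y - x'‖ + ‖b - u'‖ + ‖v - v'‖) := by
      intro ε hε
      obtain ⟨ρ, hρ, hAB⟩ := exists_adjointJacobian_bound hg w (show 0 < ε / 2 by positivity)
      obtain ⟨ε', hε', hε2, hερ⟩ : ∃ ε' > 0, 2 * ε' ≤ ε ∧ 2 * ε' ≤ ρ :=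
        ⟨min (ε / 2) (ρ / 2), by positivity, by linarith [min_le_left (ε / 2) (ρ / 2)],
          by linarith [min_le_right (ε / 2) (ρ / 2)]⟩
      obtain ⟨x', u', v', hv', hx, hu, hv, δ, hδ, H⟩ :=
        exists_of_mem_coderivative_sweepingMap hL hz hε'
      refine ⟨x', u', v', hv', by linarith, by linarith, by linarith, min δ ε', by positivity,
        fun y b v hv hy hb hvv => ?_⟩
      rw [lt_min_iff] at hy hb hvv
      have h1 := H y b v hv hy.1 hb.1 hvv.1
      have h2 := (le_abs_self _).trans (hAB y x' b u'
        (by linarith [norm_sub_le_norm_sub_add_norm_sub y x' x]) (by linarith)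
        (by linarith [norm_sub_le_norm_sub_add_norm_sub b u' u]) (by linarith))
      rw [inner_sub_left, inner_sub_left]
      have h3 : ε' * (‖y - x'‖ + ‖b - u'‖ + ‖v - v'‖) ≤
          ε / 2 * (‖y - x'‖ + ‖b - u'‖ + ‖v - v'‖) := by gcongr; linarith
      have h4 : 0 ≤ ε * ‖v - v'‖ := by positivity
      linarith
    -- `N_C` does not constrain `u`, so the `u`-direction `z.snd - B` itself can be tested, giving
    -- `‖z.snd - B‖² ≤ ε ‖z.snd - B‖`.
    have hsnd : z.snd = B := by
      have h0 : ‖z.snd - B‖ ^ 2 ≤ 0 := by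
        refine nonpos_of_forall_le_mul (r := ‖z.snd - B‖) fun ε hε => ?_
        obtain ⟨x', u', v', hv', -, -, -, δ, hδ, H⟩ := key ε hε
        have ht : 0 < δ / (‖z.snd - B‖ + 1) := by positivity
        have htn : ‖(δ / (‖z.snd - B‖ + 1)) • (z.snd - B)‖ < δ := by
          rw [norm_smul, Real.norm_of_nonneg ht.le, div_mul_eq_mul_div, div_lt_iff₀ (by positivity)]
          linarith
        have := H x' (u' + (δ / (‖z.snd - B‖ + 1)) • (z.snd - B)) v' hv' (by simpa using hδ)
          (by simpa using htn) (by simpa using hδ)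
        simp only [sub_self, inner_zero_right, add_sub_cancel_left, inner_smul_right, norm_zero,
          norm_smul, Real.norm_of_nonneg ht.le, real_inner_self_eq_norm_sq] at this
        refine le_of_mul_le_mul_left ?_ ht
        linarith
      have := pow_eq_zero_iff (two_ne_zero) |>.1 (le_antisymm h0 (by positivity))
      exact sub_eq_zero.1 (norm_eq_zero.1 this)
    refine ⟨z.fst - A, ?_, ?_⟩
    · refine mem_coderivative_of_forall (mem_sweepingMap.1 hω) one_pos
        (isClosed_gph_polyNormal.inter Metric.isClosed_closedBall) fun ε hε => ?_
      obtain ⟨x', u', v', hv', hx, hu, hv, δ, hδ, H⟩ := key ε hε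
      refine ⟨x', v', hv', hx, hv, δ, hδ, fun y v hv hy hvv => ?_⟩
      simpa using H y u' v hv hy (by simpa using hδ) hvv
    · have : adjointJacobian g x u w + WithLp.toLp 2 (z.fst - A, (0 : Euc d)) =
          WithLp.toLp 2 (A + (z.fst - A), B + 0) := rfl
      rw [this, add_zero, add_sub_cancel, ← hsnd]
      rfl
  · rintro ⟨y₀, hy₀, rfl⟩
    refine mem_coderivative_sweepingMap_of_forall hL hω fun ε hε => ?_
    obtain ⟨ρ, hρ, hAB⟩ := exists_adjointJacobian_bound hg w (show 0 < ε / 2 by positivity)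
    obtain ⟨ε', hε', hε2, hερ⟩ : ∃ ε' > 0, 2 * ε' ≤ ε ∧ 2 * ε' ≤ ρ :=
      ⟨min (ε / 2) (ρ / 2), by positivity, by linarith [min_le_left (ε / 2) (ρ / 2)],
        by linarith [min_le_right (ε / 2) (ρ / 2)]⟩
    obtain ⟨x', v', hv', hx, hv, δ, hδ, H⟩ := exists_of_mem_coderivative hy₀ hε'
    refine ⟨x', u, v', hv', by linarith, by simpa using hε, by linarith, min δ ε', by positivity,
      fun y b v hv hy hb hvv => ?_⟩
    rw [lt_min_iff] at hy hb hvv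
    have h1 := H y v hv hy.1 hvv.1
    have h2 := (neg_le_abs _).trans (hAB y x' b u
      (by linarith [norm_sub_le_norm_sub_add_norm_sub y x' x]) (by linarith) (by linarith)
      (by simpa using hρ))
    change inner ℝ (A + y₀) (y - x') + inner ℝ (B + 0) (b - u) - _ - _ ≤ _
    rw [inner_add_left, add_zero]
    have h3 : ε' * (‖y - x'‖ + ‖v - v'‖) ≤ ε / 2 * (‖y - x'‖ + ‖v - v'‖) := by
      gcongr; linarith
    have h4 : 0 ≤ ε * ‖v - v'‖ := by positivity
    have h5 : 0 ≤ ε * ‖b - u‖ := by positivity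
    linarith

end SumRule

theorem theorem4p1 {n d s : ℕ} (a : Fin s → Euc n) (c : Fin s → ℝ) (U : Set (Euc d))
    (g : Euc n → Euc d → Euc n)
    (hg : ∀ x ∈ polyhedron a c, ∀ u ∈ U, LipschitzAround g x u)
    (x : Euc n) (hx : x ∈ polyhedron a c) (u : Euc d) (hu : u ∈ U)
    (ω : Euc n) (hω : ω ∈ sweepingMap a c g (WithLp.toLp 2 (x, u))) :
    -- the coderivative upper estimate
    (∀ w : Euc n,
      coderivative (sweepingMap a c g) (WithLp.toLp 2 (x, u)) ω w ⊆
        {z | w ∈ domCoderivative (polyNormal a c) x (ω - g x u) ∧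
          ∃ v ∈ limitingSubdifferential (scalarization g w) (WithLp.toLp 2 (x, u)),
            ∃ y ∈ multiplierSums a c x w, z = v + WithLp.toLp 2 (y, 0)}) ∧
    -- the coderivative domains of the truncated and of the full normal cone mapping agree
    (∀ M : ℝ, ‖ω - g x u‖ < M →
      domCoderivative (truncNormal a c M) x (ω - g x u) =
        domCoderivative (polyNormal a c) x (ω - g x u)) ∧
    -- the domain formula under linear independence of the active constraint vectors
    (LinearIndependent ℝ (fun j : {j // j ∈ activeIdx a c x} => a j) →
      domCoderivative (polyNormal a c) x (ω - g x u) =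
        {w | ∃ l : Fin s → ℝ, (∀ j ∈ activeIdx a c x, 0 ≤ l j) ∧
          ω - g x u = ∑ j ∈ activeIdx a c x, l j • a j ∧
          ∀ j ∈ activeIdx a c x, 0 < l j → inner ℝ (a j) w = 0}) ∧
    -- the case of a perturbation that is continuously differentiable around `(x, u)`
    (ContDiffAt ℝ 1 (Function.uncurry g) (x, u) →
      (∀ w : Euc n,
        coderivative (sweepingMap a c g) (WithLp.toLp 2 (x, u)) ω w ⊆
          {z | w ∈ domCoderivative (polyNormal a c) x (ω - g x u) ∧
            ∃ y ∈ multiplierSums a c x w,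
              z = adjointJacobian g x u w + WithLp.toLp 2 (y, 0)}) ∧
      (LinearIndependent ℝ (fun j : {j // j ∈ activeIdx a c x} => a j) →
        ∀ w : Euc n,
          coderivative (sweepingMap a c g) (WithLp.toLp 2 (x, u)) ω w =
            {z | w ∈ domCoderivative (polyNormal a c) x (ω - g x u) ∧
              ∃ y ∈ multiplierSums a c x w,
                z = adjointJacobian g x u w + WithLp.toLp 2 (y, 0)})) := by
  have hL := hg x hx u hu
  refine ⟨fun w z hz => ?_, fun M hM => domCoderivative_truncNormal hM,
    domCoderivative_polyNormal_eq hx, fun hC => ⟨fun w z hz => ?_, fun hli w => ?_⟩⟩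
  · obtain ⟨v, hv, y, hy, rfl⟩ := exists_subgradient_add_of_mem_coderivative hL hω hz
    exact ⟨⟨y, hy⟩, v, hv, y, coderivative_polyNormal_subset hy, rfl⟩
  · obtain ⟨y, hy, rfl⟩ := (mem_coderivative_sweepingMap_iff hL hC hω).1 hz
    exact ⟨⟨y, hy⟩, y, coderivative_polyNormal_subset hy, rfl⟩
  · ext z
    rw [mem_coderivative_sweepingMap_iff hL hC hω]
    constructor
    · rintro ⟨y, hy, rfl⟩
      exact ⟨⟨y, hy⟩, y, coderivative_polyNormal_subset hy, rfl⟩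
    · rintro ⟨hw, y, hy, rfl⟩
      exact ⟨y, (coderivative_polyNormal_eq_of_linearIndependent hx hli hw).symm ▸ hy, rfl⟩
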